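/- Let $F$ be a field, $t\in F$, and $q$ a formal variable. **Word quasi-symmetric functions.** A word over $\{1,2,\dots\}$ is packed if its set of letters is $\{1,\dots,k\}$ for some $k\ge 0$; $\mathrm{pack}(w)$ is obtained from a word $w$ over a totally ordered alphabet by replacing each occurrence of its $k$-th smallest letter by $k$. $\mathbf{WQSym}$ has the basis $\mathbf M_u(A)=\sum_{\mathrm{pack}(w)=u}w$ ($u$ packed). On its graded dual, with dual basis $(\mathbf N_u)$, the internal product is $\mathbf N_u*\mathbf N_v=\mathbf N_{\mathrm{pack}(u,v)}$ for $|u|=|v|$ (and $0$ if $|u|\ne|v|$), biwords being packed for the lexicographic order on the pairs $(u_i,v_i)$. Noncommutative symmetric functions are embedded in the dual by $S^I=\sum_{\mathrm{ev}(u)=I}\mathbf N_u$, where $\mathrm{ev}(u)$ lists the multiplicities of the letters $1,2,\dots$ of $u$. Put $\sigma_1((1-t)A)=\big(\sum_k(-t)^k\Lambda_k\big)\big(\sum_l S_l\big)$ with $\Lambda_k=\sum_{I\vDash k}(-1)^{k-\ell(I)}S^I$, and $\mathbf N_u((1-t)A)=\mathbf N_u*\sigma_1((1-t)A)$. The map $\mathbf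 M_u(A)\mapsto \mathbf M_u(A\cdot(1-t))$ is the adjoint of $\mathbf N_v(A)\mapsto\mathbf N_v((1-t)A)$, that is, the coefficient of $\mathbf M_v(A)$ in $\mathbf M_u(A\cdot(1-t))$ is the coefficient of $\mathbf N_u$ in $\mathbf N_v((1-t)A)$. For $f\in\mathbf{WQSym}$, $f(\mathbb X)\in F[[q]]$ is obtained from $f(A\cdot(1-t))$ by specializing $A$ to the alphabet $\frac1{1-q}=\{\cdots<q^2<q<1\}$, each word being replaced by the product of its letters. **Plane trees.** A plane tree here is a finite rooted plane tree in which every internal node has at least two children. A region is a part of the plane between two consecutive edges coming from the same vertex, so that a node of arity $a$ carries $a-1$ regions. The decreasing plane tree $\mathcal T(u)$ of a word $u$ is a single leaf if $u$ is empty; otherwise, if $m$ is the maximal letter of $u$ and $u=w_0\,m\,w_1\,m\cdots m\,w_k$ with no $m$ in the $w_j$, it is the tree whose root has the subtrees $\mathcal T(w_0),\dots,\mathcal T(w_k)$ in this order. The Loday–Ronco free tridendriform algebra of plane trees is embedded in $\mathbf{WQSym}$ by sending $T$ to $\mathbf M_T=\sum_{\mathcal T(u)=T}\mathbf M_u$,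 the sum being over packed words $u$. **Theorem.** Let $T$ be a plane tree with $n\ge 1$ regions and root $\rho$. Then, in $F[[q]]$, $$\mathbf M_T(\mathbb X)=\frac{1-t^{a(\rho)-1}}{1-q^n}\prod_{i\in\mathrm{Int}(T)}\frac{q^{r(i)}-t^{a(i)-1}}{1-q^{s(i)-1}},$$ where $\mathrm{Int}(T)$ is the set of internal nodes of $T$ other than the root, $a(i)$ is the arity of $i$, and $r(i)$ and $s(i)$ are the numbers of regions and of leaves, respectively, of the subtree of $T$ rooted at $i$ (so that $s(i)-1=r(i)$). -/

import Mathlib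

/-! ## Packed words -/

section PackedWords

/-- Packing of a word over a totally ordered alphabet: every occurrence of the `k`-th smallest
letter of `w` is replaced by `k`. -/
def packWord {α : Type*} [LinearOrder α] (w : List α) : List ℕ :=
  w.map fun a => (w.toFinset.filter (· ≤ a)).card

/-- A word over the positive integers is packed if its set of letters is `{1, …, k}`
for some `k` (`k = 0` for the empty word). -/
def IsPackedWord (w : List ℕ) : Prop :=
  ∃ k : ℕ, w.toFinset = Finset.Icc 1 k

theorem length_packWord {α : Type*} [LinearOrder α] (w : List α) :
    (packWord w).length = w.length := by
  simp [packWord]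

theorem isPackedWord_packWord {α : Type*} [LinearOrder α] (w : List α) :
    IsPackedWord (packWord w) := by
  refine ⟨w.toFinset.card, ?_⟩
  have himg : (packWord w).toFinset =
      w.toFinset.image fun a => (w.toFinset.filter (· ≤ a)).card := by
    ext x
    simp [packWord]
  rw [himg]
  generalize w.toFinset = s
  apply Finset.eq_of_subset_of_card_le
  · intro x hx
    obtain ⟨a, ha, rfl⟩ := Finset.mem_image.1 hx
    refine Finset.mem_Icc.2 ⟨?_, Finset.card_filter_le _ _⟩
    exact Finset.card_pos.2 ⟨a, Finset.mem_filter.2 ⟨ha, le_rfl⟩⟩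
  · rw [Finset.card_image_of_injOn]
    · simp
    · have key : ∀ a ∈ s, ∀ b ∈ s, a < b →
          (s.filter (· ≤ a)).card < (s.filter (· ≤ b)).card := by
        intro a _ b hb hab
        apply Finset.card_lt_card
        refine ⟨fun x hx => ?_, fun h => ?_⟩
        · have hx' := Finset.mem_filter.1 hx
          exact Finset.mem_filter.2 ⟨hx'.1, hx'.2.trans hab.le⟩
        · have hb' := h (Finset.mem_filter.2 ⟨hb, le_rfl⟩)
          exact absurd (Finset.mem_filter.1 hb').2 (not_le.2 hab)
      intro a ha b hb hab
      rcases lt_trichotomy a b with h | h | h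
      · exact absurd hab (key a ha b hb h).ne
      · exact h
      · exact absurd hab (key b hb a ha h).ne'

/-- The set of packed words. -/
abbrev PackedWord : Type := {w : List ℕ // IsPackedWord w}

/-- The packed word of a word, as an element of `PackedWord`. -/
def toPacked {α : Type*} [LinearOrder α] (w : List α) : PackedWord :=
  ⟨packWord w, isPackedWord_packWord w⟩

theorem finite_packedWords (n : ℕ) : {u : PackedWord | u.1.length = n}.Finite := by
  have hfin : {l : List (Fin (n + 1)) | l.length = n}.Finite := List.finite_length_eq _ n
  refine Set.Finite.of_finite_image ((hfin.image fun l => l.map Fin.val).subset ?_)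
    (f := Subtype.val) Subtype.val_injective.injOn
  rintro _ ⟨⟨u, k, hk⟩, hu, rfl⟩
  have hu' : u.length = n := hu
  have hkn : k ≤ n := by
    have h := List.toFinset_card_le u
    rw [hk, Nat.card_Icc] at h
    omega
  have hlt : ∀ a ∈ u, a < n + 1 := fun a ha => by
    have h := List.mem_toFinset.2 ha
    rw [hk, Finset.mem_Icc] at h
    omega
  refine ⟨u.pmap (fun a h => (⟨a, h⟩ : Fin (n + 1))) hlt, ?_, ?_⟩
  · simpa using hu'
  · simp [List.map_pmap]

/-- The packed words of length `n`. -/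
noncomputable def packedWords (n : ℕ) : Finset PackedWord := (finite_packedWords n).toFinset

/-- The evaluation `(|u|₁, …, |u|ₖ)` of a packed word with maximal letter `k`; it is a composition
of the length of `u`. -/
def PackedWord.ev (u : PackedWord) : List ℕ :=
  (List.range' 1 (u.1.foldr max 0)).map fun j => u.1.count j

end PackedWords

/-! ## Noncommutative symmetric functions -/

section NoncommutativeSymmetricFunctions

/-- The algebra `Sym` of noncommutative symmetric functions: the free associative algebra on
`S₁, S₂, …`; the basis element indexed by `I = (i₁, …, iᵣ)` is `S^I = S_{i₁} ⋯ S_{iᵣ}`. -/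
abbrev NCSym (F : Type*) [Field F] : Type _ := MonoidAlgebra F (FreeMonoid ℕ+)

/-- The complete function `Sₙ`, with `S₀ = 1`. -/
noncomputable def NCSym.S (F : Type*) [Field F] (n : ℕ) : NCSym F :=
  if h : 0 < n then MonoidAlgebra.single (FreeMonoid.of ⟨n, h⟩) 1 else 1

/-- The elementary function `Λₙ = ∑_{I ⊨ n} (-1)^{n - ℓ(I)} S^I`. -/
noncomputable def NCSym.Lam (F : Type*) [Field F] (n : ℕ) : NCSym F :=
  ∑ I : Composition n, (-1 : F) ^ (n - I.length) • (I.blocks.map (NCSym.S F)).prod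

/-- The component of degree `n` of
`σ₁((1-t)A) = λ_{-t}(A) σ₁(A) = (∑ₖ (-t)^k Λₖ) (∑ₗ Sₗ)`. -/
noncomputable def NCSym.sigmaOneMinus {F : Type*} [Field F] (t : F) (n : ℕ) : NCSym F :=
  ∑ k ∈ Finset.range (n + 1), (-t) ^ k • (NCSym.Lam F k * NCSym.S F (n - k))

end NoncommutativeSymmetricFunctions

/-! ## Word quasi-symmetric functions -/

section WordQuasiSymmetricFunctions

/-- `WQSym`, through the coordinates in its basis `(M_u)` indexed by packed words. -/
abbrev WQSym (F : Type*) [Field F] : Type _ := PackedWord →₀ F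

/-- The graded dual `WQSym*`, through the coordinates in the basis `(N_u)` dual to `(M_u)`. -/
abbrev WQSymDual (F : Type*) [Field F] : Type _ := PackedWord →₀ F

/-- The basis element `M_u`. -/
noncomputable def WQSym.M (F : Type*) [Field F] (u : PackedWord) : WQSym F := Finsupp.single u 1

/-- The basis element `N_u`. -/
noncomputable def WQSymDual.N (F : Type*) [Field F] (u : PackedWord) : WQSymDual F :=
  Finsupp.single u 1

/-- The realization `M_u(A) = ∑_{pack(w) = u} w` of `M_u` over an ordered alphabet `A`, as a formal
sum of words: the value at `w` is the coefficient of the word `w`. -/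
def WQSym.realM (F : Type*) [Field F] (A : Type*) [LinearOrder A] (u : PackedWord) :
    List A → F :=
  fun w => if toPacked w = u then 1 else 0

/-- The internal product of `WQSym*`: `N_u * N_v = N_{pack(u,v)}` if `u` and `v` have the same
length, and `0` otherwise, where the letters `(uᵢ, vᵢ)` of the biword are ordered
lexicographically. -/
noncomputable def WQSymDual.internalMul {F : Type*} [Field F] (f g : WQSymDual F) : WQSymDual F :=
  f.sum fun u a => g.sum fun v b =>
    if u.1.length = v.1.length then
      (a * b) • WQSymDual.N F (toPacked (List.zipWith (fun x y => toLex (x, y)) u.1 v.1))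
    else 0

/-- The embedding of `Sym` in `WQSym*` given by `S^I = ∑_{ev(u) = I} N_u`. -/
noncomputable def NCSym.toWQSymDual (F : Type*) [Field F] : NCSym F → WQSymDual F :=
  fun f => f.coeff.sum fun I a =>
    a • ∑ u ∈ packedWords ((I.toList.map fun i : ℕ+ => (i : ℕ)).sum) with
      u.ev = I.toList.map (fun i : ℕ+ => (i : ℕ)), WQSymDual.N F u

/-- `N_u((1-t)A) = N_u(A) * σ₁((1-t)A)`. -/
noncomputable def WQSymDual.NOneMinus {F : Type*} [Field F] (t : F) (u : PackedWord) :
    WQSymDual F :=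
  WQSymDual.internalMul (WQSymDual.N F u)
    (NCSym.toWQSymDual F (NCSym.sigmaOneMinus t u.1.length))

/-- The adjoint `f(A) ↦ f(A·(1-t))` on `WQSym` of the degree-preserving map
`N_v(A) ↦ N_v((1-t)A)` of `WQSym*`: the coefficient of `M_v(A)` in `M_u(A·(1-t))` is the
coefficient of `N_u(A)` in `N_v((1-t)A)`. -/
noncomputable def WQSym.timesOneMinus {F : Type*} [Field F] (t : F) : WQSym F →ₗ[F] WQSym F :=
  Finsupp.linearCombination F fun u =>
    ∑ v ∈ packedWords u.1.length, (WQSymDual.NOneMinus t v) u • WQSym.M F v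

/-- The specialization `A = 1/(1-q) = {⋯ < q² < q < 1}`: every letter of every word of `f(A)` is
replaced by the corresponding power of the formal variable `q` (the variable `X` of `F⟦X⟧`).
The letter `q^i` is represented by `i : ℕᵒᵈ`, since `q^i < q^j` in the alphabet iff `i > j`;
the sum below runs over the words `q^{w 0} q^{w 1} ⋯` of length `|u|` whose product is `q^m`. -/
noncomputable def WQSym.atGeometric (F : Type*) [Field F] : WQSym F →ₗ[F] PowerSeries F :=
  Finsupp.linearCombination F fun u => PowerSeries.mk fun m =>
    ∑ w ∈ Finset.Nat.antidiagonalTuple u.1.length m,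
      WQSym.realM F ℕᵒᵈ u (List.ofFn fun i => OrderDual.toDual (w i))

/-- The specialization `f(𝕏)`, `𝕏 = 1/(1-q) ×̂ (1-t)`: take `A = 1/(1-q)` in `f(A·(1-t))`. -/
noncomputable def WQSym.atX {F : Type*} [Field F] (t : F) : WQSym F →ₗ[F] PowerSeries F :=
  WQSym.atGeometric F ∘ₗ WQSym.timesOneMinus t

end WordQuasiSymmetricFunctions

/-! ## Plane trees -/

/-- Plane trees in which every internal node has at least two children: `node k c` has a root with
the `k + 2` ordered subtrees `c 0, …, c (k + 1)`. -/
inductive PlaneTree : Type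
  | leaf : PlaneTree
  | node (k : ℕ) (c : Fin (k + 2) → PlaneTree) : PlaneTree

namespace PlaneTree

/-- The arity of the root. -/
def arity : PlaneTree → ℕ
  | leaf => 0
  | node k _ => k + 2

/-- The number of regions (parts of the plane between two consecutive edges coming from the same
vertex): a vertex of arity `a` carries `a - 1` regions. -/
def regions : PlaneTree → ℕ
  | leaf => 0
  | node k c => (k + 1) + ∑ i, (c i).regions

/-- The number of leaves. -/
def leaves : PlaneTree → ℕ
  | leaf => 1
  | node _ c => ∑ i, (c i).leaves

/-- The subtrees rooted at the internal nodes (root included), one for each node. -/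
def internalNodes : PlaneTree → Multiset PlaneTree
  | leaf => 0
  | node k c => node k c ::ₘ ∑ i, (c i).internalNodes

/-- The subtrees rooted at the internal nodes other than the root, one for each node. -/
def properInternalNodes : PlaneTree → Multiset PlaneTree
  | leaf => 0
  | node _ c => ∑ i, (c i).internalNodes

theorem length_splitOn_getD_lt {u : List ℕ} {m : ℕ} (h : m ∈ u) (i : ℕ) :
    ((u.splitOn m).getD i []).length < u.length := by
  induction u generalizing i with
  | nil => simp at h
  | cons a l ih =>
    have hle : ∀ j, ((l.splitOn m).getD j []).length ≤ l.length := by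
      intro j
      by_cases hm : m ∈ l
      · exact (ih hm j).le
      · rw [List.splitOn_eq_singleton hm]
        cases j <;> simp
    rw [List.splitOn_cons_eq_if_modifyHead]
    by_cases ha : a = m
    · subst ha
      cases i with
      | zero => simp
      | succ i => simpa [Nat.lt_succ_iff] using hle i
    · have hl : m ∈ l := by
        rcases List.mem_cons.1 h with h' | h'
        · exact absurd h'.symm ha
        · exact h'
      have hlt := ih hl i
      have hne := List.splitOn_ne_nil m l
      rw [if_neg (by simpa using ha)]
      revert hlt hne
      generalize l.splitOn m = L
      intro hlt hne
      cases L with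
      | nil => exact absurd rfl hne
      | cons p ps =>
        cases i with
        | zero => simpa using hlt
        | succ i => simpa using Nat.lt_succ_of_lt hlt

/-- The decreasing plane tree of a word: a leaf for the empty word; otherwise, if `m` is the maximal
letter and `u = w₀ m w₁ m ⋯ m w_{k+1}` with no `m` in the `wᵢ`, a root with the `k + 2` subtrees
associated with `w₀, …, w_{k+1}`. -/
def decreasing (u : List ℕ) : PlaneTree :=
  match h : u.max? with
  | none => leaf
  | some m => node (u.count m - 1) fun i => decreasing ((u.splitOn m).getD i [])
termination_by u.length
decreasing_by exact length_splitOn_getD_lt (List.max?_mem h) i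

open Classical in
/-- The element `M_T = ∑_{𝒯(u) = T} M_u` of `WQSym`, the sum being over the packed words `u` whose
decreasing plane tree is `T` (their length is the number of regions of `T`). -/
noncomputable def MT (F : Type*) [Field F] (T : PlaneTree) : WQSym F :=
  ∑ u ∈ packedWords T.regions with decreasing u.1 = T, WQSym.M F u

end PlaneTree

/-! The coefficient of q^m in M_T(𝕏) is a sum over pairs (x, w), where x is a word in powers of q
with product q^m and w is a packed word, such that the packed biword has decreasing tree T; the pair
is weighted by the coefficient of N_w in σ₁((1-t)A) (`PlaneTree.coeff_atX_MT`). Words with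
decreasing tree T are the left-to-right readings of the labelings of the internal nodes that
increase strictly towards the root (`decreasing_packWord_eq_iff`). A biword is therefore a pair of
labelings: exponents ξ that increase weakly away from the root, and letters ω that increase strictly
towards the root along nodes with equal exponent.

If w has n letters and maximal letter k ≥ 1, its weight is (-1)^k (t^n - t^(n - |w|_k)), where |w|_k
is the multiplicity of k (`NCSym.toWQSymDual_sigmaOneMinus_apply`). For fixed ξ, the sum of these
weights over ω factorizes over the nodes: a node carrying b regions gives -t^b if some proper
ancestor has the same exponent, and 1 - t^b otherwise (`sum_strictPackings_oneMinus`). This comes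
from peeling off the top level of ω and an inclusion-exclusion over its possible values.

The remaining sum over ξ is computed recursively on the tree (`labelingSum_node`,
`mk_labelingSum_eq`). For a subtree with n regions below a node of exponent p, whose own root
carries b regions, the sum over the exponent r ≥ p of that root is ∑ q^(nr) (1 - t^b) - q^(np) =
q^(np) (q^n - t^b) / (1 - q^n): the tie at r = p changes the numerator 1 - t^b into q^n - t^b. The
root of T has nothing to be tied to and keeps 1 - t^b. Exponents are bounded by N and identities are
taken modulo q^N, so that all sums are finite; N = m + 1 suffices for the coefficient of q^m. -/

/-! ### Alternating sums over strict packings of a finite set with an acyclic relation. -/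

section StrictPackings

variable {α : Type*} [Fintype α] [DecidableEq α]

/-- The elements of `s` lying below no element of `s` for the relation `R`. -/
noncomputable def maximals (R : α → α → Prop) (s : Finset α) : Finset α :=
  open Classical in s.filter fun x => ∀ y ∈ s, ¬ R x y

/-- `ω` vanishes outside `s`, takes on `s` exactly the values `1, …, k` for some `k`, and is
strictly increasing on `s` for the relation `R`. -/
def IsStrictPacking (R : α → α → Prop) (s : Finset α) (ω : α → ℕ) : Prop :=
  (∀ x ∉ s, ω x = 0) ∧ (∃ k, s.image ω = Finset.Icc 1 k) ∧
    ∀ x ∈ s, ∀ y ∈ s, R x y → ω x < ω y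

/-- The strict packings of `s`. -/
noncomputable def strictPackings (R : α → α → Prop) (s : Finset α) : Finset (α → ℕ) :=
  open Classical in
  (Fintype.piFinset fun _ => Finset.range (s.card + 1)).filter (IsStrictPacking R s)

variable {R : α → α → Prop} {s : Finset α}

theorem mem_maximals {x : α} : x ∈ maximals R s ↔ x ∈ s ∧ ∀ y ∈ s, ¬ R x y := by
  simp [maximals]

/-- The value 0 taken outside `s` does not affect the supremum, so the number of levels can be read
off without reference to `s`. -/
theorem sup_eq_of_image_eq_Icc {ω : α → ℕ} (h0 : ∀ x ∉ s, ω x = 0) {k : ℕ}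
    (hk : s.image ω = Finset.Icc 1 k) : Finset.univ.sup ω = k := by
  apply le_antisymm
  · refine Finset.sup_le fun x _ => ?_
    by_cases hx : x ∈ s
    · have h := Finset.mem_image_of_mem ω hx
      rw [hk, Finset.mem_Icc] at h
      exact h.2
    · simp [h0 x hx]
  · rcases Nat.eq_zero_or_pos k with rfl | hpos
    · exact Nat.zero_le _
    · have h : k ∈ s.image ω := by rw [hk, Finset.mem_Icc]; omega
      obtain ⟨x, -, rfl⟩ := Finset.mem_image.1 h
      exact Finset.le_sup (Finset.mem_univ x)

theorem IsStrictPacking.image_eq {ω : α → ℕ} (h : IsStrictPacking R s ω) :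
    s.image ω = Finset.Icc 1 (Finset.univ.sup ω) := by
  obtain ⟨h0, ⟨k, hk⟩, -⟩ := h
  rw [sup_eq_of_image_eq_Icc h0 hk, hk]

theorem mem_strictPackings {ω : α → ℕ} : ω ∈ strictPackings R s ↔ IsStrictPacking R s ω := by
  simp only [strictPackings, Finset.mem_filter, Fintype.mem_piFinset, Finset.mem_range,
    and_iff_right_iff_imp]
  intro h x
  have hc := Finset.card_image_le (s := s) (f := ω)
  rw [h.image_eq, Nat.card_Icc] at hc
  have := Finset.le_sup (f := ω) (Finset.mem_univ x)
  omega

/-- The extension of a packing by a new top level `S`. -/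
def addTop (S : Finset α) (ω : α → ℕ) : α → ℕ :=
  fun x => if x ∈ S then Finset.univ.sup ω + 1 else ω x

theorem sup_addTop {S : Finset α} (hS : S.Nonempty) (ω : α → ℕ) :
    Finset.univ.sup (addTop S ω) = Finset.univ.sup ω + 1 := by
  obtain ⟨x, hx⟩ := hS
  apply le_antisymm
  · refine Finset.sup_le fun y _ => ?_
    have := Finset.le_sup (f := ω) (Finset.mem_univ y)
    unfold addTop
    split_ifs <;> omega
  · have := Finset.le_sup (f := addTop S ω) (Finset.mem_univ x)
    simpa [addTop, hx] using this

theorem addTop_eq_sup_iff {S : Finset α} (hS : S.Nonempty) (ω : α → ℕ) (x : α) :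
    addTop S ω x = Finset.univ.sup (addTop S ω) ↔ x ∈ S := by
  rw [sup_addTop hS]
  have := Finset.le_sup (f := ω) (Finset.mem_univ x)
  unfold addTop
  split_ifs with h
  · simp [h]
  · simp only [h, iff_false]; omega

/-- A maximal element has nothing above it in `s`, so raising `S` one level above everything else
violates no inequality. -/
theorem isStrictPacking_addTop {S : Finset α} (hSM : S ⊆ maximals R s) (hS : S.Nonempty)
    {ω : α → ℕ} (h : IsStrictPacking R (s \ S) ω) : IsStrictPacking R s (addTop S ω) := by
  have hSs : S ⊆ s := fun x hx => (mem_maximals.1 (hSM hx)).1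
  have himg := h.image_eq
  refine ⟨fun x hx => ?_, ⟨Finset.univ.sup ω + 1, ?_⟩, fun x hx y hy hxy => ?_⟩
  · have hxS : x ∉ S := fun hx' => hx (hSs hx')
    simp only [addTop, if_neg hxS]
    exact h.1 x (by simp [hx])
  · rw [← Finset.sdiff_union_of_subset hSs, Finset.image_union]
    have h1 : (s \ S).image (addTop S ω) = (s \ S).image ω :=
      Finset.image_congr fun x hx => by
        simp only [Finset.coe_sdiff, Set.mem_sdiff, Finset.mem_coe] at hx
        simp [addTop, hx.2]
    have h2 : S.image (addTop S ω) = {Finset.univ.sup ω + 1} := by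
      ext j
      simp only [Finset.mem_image, Finset.mem_singleton]
      constructor
      · rintro ⟨x, hx, rfl⟩; simp [addTop, hx]
      · rintro rfl
        obtain ⟨x, hx⟩ := hS
        exact ⟨x, hx, by simp [addTop, hx]⟩
    rw [h1, h2, himg]
    ext j
    simp only [Finset.mem_union, Finset.mem_Icc, Finset.mem_singleton]
    omega
  · have hxS : x ∉ S := fun hx' => (mem_maximals.1 (hSM hx')).2 y hy hxy
    have := Finset.le_sup (f := ω) (Finset.mem_univ x)
    by_cases hyS : y ∈ S
    · simp only [addTop, if_neg hxS, if_pos hyS]; omega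
    · simp only [addTop, if_neg hxS, if_neg hyS]
      exact h.2.2 x (by simp [hx, hxS]) y (by simp [hy, hyS]) hxy

/-- The top level of a packing. -/
def topLevel (s : Finset α) (ω : α → ℕ) : Finset α := s.filter fun x => ω x = Finset.univ.sup ω

/-- The packing obtained by deleting the top level. -/
def removeTop (ω : α → ℕ) : α → ℕ := fun x => if ω x = Finset.univ.sup ω then 0 else ω x

theorem IsStrictPacking.topLevel_nonempty {ω : α → ℕ} (h : IsStrictPacking R s ω)
    (hs : s.Nonempty) : (topLevel s ω).Nonempty := by
  have himg := h.image_eq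
  obtain ⟨x, hx⟩ := hs
  have h1 := Finset.mem_image_of_mem ω hx
  rw [himg, Finset.mem_Icc] at h1
  have h2 : Finset.univ.sup ω ∈ s.image ω := by rw [himg, Finset.mem_Icc]; omega
  obtain ⟨y, hy, hy'⟩ := Finset.mem_image.1 h2
  exact ⟨y, Finset.mem_filter.2 ⟨hy, hy'⟩⟩

theorem IsStrictPacking.topLevel_subset {ω : α → ℕ} (h : IsStrictPacking R s ω) :
    topLevel s ω ⊆ maximals R s := by
  intro x hx
  obtain ⟨hxs, hx⟩ := Finset.mem_filter.1 hx
  refine mem_maximals.2 ⟨hxs, fun y hy hxy => ?_⟩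
  have h1 := h.2.2 x hxs y hy hxy
  have := Finset.le_sup (f := ω) (Finset.mem_univ y)
  omega

/-- The levels are consecutive integers, so deleting the highest one leaves a packing with exactly
one level fewer; this makes removal inverse to `addTop`. -/
theorem IsStrictPacking.removeTop {ω : α → ℕ} (h : IsStrictPacking R s ω) (hs : s.Nonempty) :
    IsStrictPacking R (s \ topLevel s ω) (removeTop ω) ∧
      Finset.univ.sup (_root_.removeTop ω) + 1 = Finset.univ.sup ω := by
  have himg := h.image_eq
  obtain ⟨y, hy⟩ := h.topLevel_nonempty hs
  obtain ⟨hys, hy⟩ := Finset.mem_filter.1 hy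
  have hpos := Finset.mem_image_of_mem ω hys
  rw [himg, hy, Finset.mem_Icc] at hpos
  have h0 : ∀ x ∉ s \ topLevel s ω, _root_.removeTop ω x = 0 := by
    intro x hx
    by_cases hxs : x ∈ s
    · have hx' : ω x = Finset.univ.sup ω := by
        by_contra hne
        exact hx (by simp [topLevel, hxs, hne])
      simp [_root_.removeTop, hx']
    · simp [_root_.removeTop, h.1 x hxs]
  have himg' : (s \ topLevel s ω).image (_root_.removeTop ω) =
      Finset.Icc 1 (Finset.univ.sup ω - 1) := by
    ext j
    simp only [Finset.mem_image, Finset.mem_Icc]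
    constructor
    · rintro ⟨x, hx, rfl⟩
      simp only [topLevel, Finset.mem_sdiff, Finset.mem_filter, not_and] at hx
      have h1 := Finset.mem_image_of_mem ω hx.1
      rw [himg, Finset.mem_Icc] at h1
      have h2 := hx.2 hx.1
      simp only [_root_.removeTop, if_neg h2]
      omega
    · intro hj
      have hj' : j ∈ s.image ω := by rw [himg, Finset.mem_Icc]; omega
      obtain ⟨x, hx, rfl⟩ := Finset.mem_image.1 hj'
      have hne : ω x ≠ Finset.univ.sup ω := by omega
      exact ⟨x, by simp [topLevel, hx, hne], by simp [_root_.removeTop, hne]⟩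
  refine ⟨⟨h0, ⟨_, himg'⟩, fun x hx z hz hxz => ?_⟩, ?_⟩
  · simp only [topLevel, Finset.mem_sdiff, Finset.mem_filter, not_and] at hx hz
    simp only [_root_.removeTop, if_neg (hx.2 hx.1), if_neg (hz.2 hz.1)]
    exact h.2.2 x hx.1 z hz.1 hxz
  · rw [sup_eq_of_image_eq_Icc h0 himg']; omega

/-- A sum over the strict packings of `s`, organized by their top levels. -/
theorem sum_strictPackings {β : Type*} [AddCommMonoid β] (hs : s.Nonempty) (f : (α → ℕ) → β) :
    ∑ ω ∈ strictPackings R s, f ω =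
      ∑ S ∈ (maximals R s).powerset.erase ∅, ∑ ω ∈ strictPackings R (s \ S), f (addTop S ω) := by
  rw [Finset.sum_sigma']
  have hback : ∀ ω, IsStrictPacking R s ω → addTop (topLevel s ω) (removeTop ω) = ω := by
    intro ω h
    obtain ⟨-, hsup⟩ := h.removeTop hs
    funext x
    by_cases hx : ω x = Finset.univ.sup ω
    · have hxs : x ∈ s := by
        by_contra hxs
        have := h.1 x hxs
        omega
      simp only [addTop, topLevel, Finset.mem_filter, hxs, hx, and_self, if_true, hsup]
    · simp [addTop, topLevel, hx, removeTop]
  refine Finset.sum_bij' (fun ω _ => ⟨topLevel s ω, removeTop ω⟩) (fun p _ => addTop p.1 p.2)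
    ?_ ?_ ?_ ?_ ?_
  · intro ω hω
    have h := mem_strictPackings.1 hω
    simp only [Finset.mem_sigma, Finset.mem_erase, Finset.mem_powerset, mem_strictPackings]
    exact ⟨⟨(h.topLevel_nonempty hs).ne_empty, h.topLevel_subset⟩, (h.removeTop hs).1⟩
  · rintro ⟨S, ω⟩ hp
    simp only [Finset.mem_sigma, Finset.mem_erase, Finset.mem_powerset, mem_strictPackings] at hp ⊢
    exact isStrictPacking_addTop hp.1.2 (Finset.nonempty_iff_ne_empty.2 hp.1.1) hp.2
  · intro ω hω
    exact hback ω (mem_strictPackings.1 hω)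
  · rintro ⟨S, ω⟩ hp
    simp only [Finset.mem_sigma, Finset.mem_erase, Finset.mem_powerset, mem_strictPackings] at hp
    obtain ⟨⟨hne, hSM⟩, h⟩ := hp
    have hS := Finset.nonempty_iff_ne_empty.2 hne
    have h1 : topLevel s (addTop S ω) = S := by
      ext x
      simp only [topLevel, Finset.mem_filter, addTop_eq_sup_iff hS, and_iff_right_iff_imp]
      exact fun hx => (mem_maximals.1 (hSM hx)).1
    have h2 : removeTop (addTop S ω) = ω := by
      funext x
      simp only [removeTop, addTop_eq_sup_iff hS]
      split_ifs with hx
      · exact (h.1 x (by simp [hx])).symm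
      · simp [addTop, hx]
    simp only [h1, h2]
  · intro ω hω
    simp only [hback ω (mem_strictPackings.1 hω)]

theorem maximals_nonempty {d : α → ℕ} (hd : ∀ x y, R x y → d y < d x) (hs : s.Nonempty) :
    (maximals R s).Nonempty := by
  obtain ⟨x, hx, hmin⟩ := s.exists_min_image d hs
  exact ⟨x, mem_maximals.2 ⟨hx, fun y hy hxy => absurd (hd x y hxy) (not_lt.2 (hmin y hy))⟩⟩

/-- Up to the constant sign (-1)^|s \ M|, this is the expansion of the product of 1 + (-1) over the
nonempty set `M`. -/
theorem sum_powerset_neg_one_pow_card_sub {α K : Type*} [DecidableEq α] [CommRing K] {M s : Finset α}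
    (hMs : M ⊆ s) (hM : M.Nonempty) : ∑ S ∈ M.powerset, (-1 : K) ^ (s \ S).card = 0 := by
  have h := Finset.prod_add (fun _ => (1 : K)) (fun _ => -1) M
  simp only [add_neg_cancel, Finset.prod_const, hM.card_ne_zero, ne_eq, not_false_eq_true,
    zero_pow, one_pow, one_mul] at h
  calc ∑ S ∈ M.powerset, (-1 : K) ^ (s \ S).card
      = ∑ S ∈ M.powerset, (-1 : K) ^ (s \ M).card * (-1) ^ (M \ S).card := by
        refine Finset.sum_congr rfl fun S hS => ?_
        have hSM := Finset.mem_powerset.1 hS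
        rw [← pow_add, Finset.card_sdiff_of_subset hMs, Finset.card_sdiff_of_subset hSM,
          Finset.card_sdiff_of_subset (hSM.trans hMs)]
        have := Finset.card_le_card hMs
        have := Finset.card_le_card hSM
        congr 1
        omega
    _ = 0 := by rw [← Finset.mul_sum, ← h, mul_zero]

/-- Peeling off a nonempty top level `S` costs one sign and leaves (-1)^|s \ S| by induction. The
sum of these signs over all sets of maximal elements vanishes, so the nonempty ones cancel the term
of the empty set. The rank `d` excludes cycles of `R` and hence guarantees that maximal elements
exist. -/
theorem sum_strictPackings_neg_one_pow {K : Type*} [CommRing K] {d : α → ℕ}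
    (hd : ∀ x y, R x y → d y < d x) (s : Finset α) :
    ∑ ω ∈ strictPackings R s, (-1 : K) ^ Finset.univ.sup ω = (-1) ^ s.card := by
  induction s using Finset.strongInduction with
  | H s ih =>
    rcases s.eq_empty_or_nonempty with rfl | hs
    · have h : strictPackings R (∅ : Finset α) = {0} := by
        ext ω
        rw [mem_strictPackings, Finset.mem_singleton]
        constructor
        · rintro ⟨h0, -⟩
          exact funext fun x => h0 x (Finset.notMem_empty x)
        · rintro rfl
          exact ⟨fun _ _ => rfl, ⟨0, by simp⟩, by simp⟩
      rw [h, Finset.sum_singleton, Finset.card_empty]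
      congr 1
      exact Nat.le_zero.1 (Finset.sup_le fun x _ => le_rfl)
    · have hMs : maximals R s ⊆ s := fun x hx => (mem_maximals.1 hx).1
      have h0 := sum_powerset_neg_one_pow_card_sub (K := K) hMs (maximals_nonempty hd hs)
      rw [← Finset.add_sum_erase _ _ (Finset.empty_mem_powerset (maximals R s)),
        Finset.sdiff_empty] at h0
      rw [sum_strictPackings hs, eq_neg_of_add_eq_zero_left h0, ← Finset.sum_neg_distrib]
      refine Finset.sum_congr rfl fun S hS => ?_
      rw [Finset.mem_erase, Finset.mem_powerset] at hS
      have hS' := Finset.nonempty_iff_ne_empty.2 hS.1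
      rw [← ih (s \ S) (Finset.sdiff_ssubset (hS.2.trans hMs) hS'), ← Finset.sum_neg_distrib]
      exact Finset.sum_congr rfl fun ω _ => by rw [sup_addTop hS', pow_succ, mul_neg_one]

/-- The value at `1 - t` of the generating function of the strict packings of a finite set with
weights `τ`. -/
theorem sum_strictPackings_oneMinus {K : Type*} [CommRing K] [Nonempty α] {d : α → ℕ}
    (hd : ∀ x y, R x y → d y < d x) (τ : α → K) :
    open Classical in
    ∑ ω ∈ strictPackings R Finset.univ, (-1 : K) ^ Finset.univ.sup ω *
        (∏ x, τ x - ∏ x with ω x ≠ Finset.univ.sup ω, τ x) =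
      ∏ x, if ∃ y, R x y then - τ x else 1 - τ x := by
  classical
  set M := maximals R Finset.univ with hM
  have hMne : M.Nonempty := maximals_nonempty hd Finset.univ_nonempty
  have hmem : ∀ x, x ∈ M ↔ ¬ ∃ y, R x y := fun x => by simp [hM, mem_maximals]
  rw [sum_strictPackings Finset.univ_nonempty]
  have hstep : ∀ S ∈ M.powerset.erase ∅, ∑ ω ∈ strictPackings R (Finset.univ \ S),
      (-1 : K) ^ Finset.univ.sup (addTop S ω) * (∏ x, τ x -
        ∏ x with addTop S ω x ≠ Finset.univ.sup (addTop S ω), τ x) =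
      ∏ x ∈ Finset.univ \ S, (- τ x) - (-1) ^ (Finset.univ \ S).card * ∏ x, τ x := by
    intro S hS
    have hS' := Finset.nonempty_iff_ne_empty.2 (Finset.mem_erase.1 hS).1
    have hf : ∀ ω : α → ℕ, (Finset.univ.filter fun x =>
        addTop S ω x ≠ Finset.univ.sup (addTop S ω)) = Finset.univ \ S := by
      intro ω
      ext x
      simp [addTop_eq_sup_iff hS']
    simp only [hf, Finset.prod_neg]
    simp only [sup_addTop hS', pow_succ]
    rw [← Finset.sum_mul, ← Finset.sum_mul, sum_strictPackings_neg_one_pow hd]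
    ring
  -- The term of `S = ∅` is zero, so it can be put back; the sum then runs over a full powerset,
  -- where the part proportional to `∏ x, τ x` cancels.
  rw [Finset.sum_congr rfl hstep, Finset.sum_erase _ (by simp [Finset.prod_neg]),
    Finset.sum_sub_distrib, ← Finset.sum_mul,
    sum_powerset_neg_one_pow_card_sub (Finset.subset_univ M) hMne, zero_mul, sub_zero]
  -- Non-maximal elements never lie in `S` and always contribute -τ; the sum over `S` is the
  -- expansion of the product of 1 + (-τ) over the maximal ones.
  have hsplit : ∀ S ∈ M.powerset, ∏ x ∈ Finset.univ \ S, (- τ x) =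
      (∏ x ∈ Finset.univ \ M, (- τ x)) * ((∏ x ∈ S, 1) * ∏ x ∈ M \ S, (- τ x)) := by
    intro S hS
    have hSM := Finset.mem_powerset.1 hS
    rw [Finset.prod_const_one, one_mul, ← Finset.prod_union]
    · congr 1
      ext x
      have : x ∈ S → x ∈ M := fun h => hSM h
      simp only [Finset.mem_sdiff, Finset.mem_univ, Finset.mem_union, true_and]
      tauto
    · exact Finset.disjoint_left.2 fun x hx hx' =>
        (Finset.mem_sdiff.1 hx).2 (Finset.mem_sdiff.1 hx').1
  rw [Finset.sum_congr rfl hsplit, ← Finset.mul_sum, ← Finset.prod_add,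
    ← Finset.prod_sdiff (Finset.subset_univ M)]
  congr 1
  · refine Finset.prod_congr rfl fun x hx => ?_
    have := (Finset.mem_sdiff.1 hx).2
    rw [hmem, not_not] at this
    rw [if_pos this]
  · refine Finset.prod_congr rfl fun x hx => ?_
    rw [if_neg ((hmem x).1 hx)]
    ring

end StrictPackings

/-! ### Words cut at the occurrences of a letter. -/

section Intercalate

variable {A B : Type*}

theorem List.map_intercalate_singleton (f : A → B) (a : A) (L : List (List A)) :
    ([a].intercalate L).map f = [f a].intercalate (L.map (List.map f)) := by
  induction L with
  | nil => simp
  | cons l L ih =>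
    cases L with
    | nil => simp
    | cons l' L => simp_all

theorem List.mem_intercalate_singleton {a b : A} {L : List (List A)} :
    b ∈ [a].intercalate L ↔ (∃ l ∈ L, b ∈ l) ∨ b = a ∧ 2 ≤ L.length := by
  induction L with
  | nil => simp
  | cons l L ih =>
    cases L with
    | nil => simp
    | cons l' L =>
      rw [List.intercalate_cons_cons, List.mem_append, ih]
      have hlen : 2 ≤ (l :: l' :: L).length := by simp
      simp only [hlen, List.mem_append, List.mem_singleton, List.exists_mem_cons_iff]
      by_cases h : b = a <;> simp [h]

theorem List.sum_intercalate_singleton {M : Type*} [AddCommMonoid M] (a : M) (L : List (List M)) :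
    ([a].intercalate L).sum = (L.map List.sum).sum + (L.length - 1) • a := by
  induction L with
  | nil => simp
  | cons l L ih =>
    cases L with
    | nil => simp
    | cons l' L =>
      rw [List.intercalate_cons_cons, List.sum_append, ih]
      simp [add_nsmul]
      abel

theorem List.count_intercalate_singleton [DecidableEq A] (a : A) (L : List (List A))
    (h : ∀ l ∈ L, a ∉ l) : ([a].intercalate L).count a = L.length - 1 := by
  induction L with
  | nil => simp
  | cons l L ih =>
    cases L with
    | nil => simpa [List.count_eq_zero] using h
    | cons l' L =>
      rw [List.intercalate_cons_cons, List.count_append, ih fun x hx => h x (by simp [hx])]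
      have := List.count_eq_zero.2 (h l (by simp))
      simp [this]
      omega

theorem List.notMem_of_mem_splitOn [DecidableEq A] {a : A} {u l : List A} (hl : l ∈ u.splitOn a) :
    a ∉ l := by
  induction u generalizing l with
  | nil => simp at hl; simp [hl]
  | cons b u ih =>
    rw [List.splitOn_cons_eq_if_modifyHead] at hl
    split_ifs at hl with h
    · rcases List.mem_cons.1 hl with rfl | hl
      · simp
      · exact ih hl
    · revert hl ih
      generalize u.splitOn a = L
      intro ih hl
      cases L with
      | nil => simp at hl
      | cons p L =>
        rcases List.mem_cons.1 hl with rfl | hl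
        · have hp := ih (l := p) (by simp)
          have hb : b ≠ a := by simpa using h
          simp [hp, hb.symm]
        · exact ih (List.mem_cons_of_mem _ hl)

theorem List.length_splitOn [DecidableEq A] (a : A) (u : List A) :
    (u.splitOn a).length = u.count a + 1 := by
  have hne := List.splitOn_ne_nil a u
  have h := List.count_intercalate_singleton a (u.splitOn a) fun l hl => List.notMem_of_mem_splitOn hl
  rw [List.intercalate_splitOn] at h
  have := List.length_pos_iff.2 hne
  omega

end Intercalate

/-! ### Internal nodes of a plane tree and the ancestor relation. -/

namespace PlaneTree

/-- The internal nodes of a plane tree. -/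
inductive Node : PlaneTree → Type
  | root (k : ℕ) (c : Fin (k + 2) → PlaneTree) : Node (node k c)
  | child {k : ℕ} {c : Fin (k + 2) → PlaneTree} (i : Fin (k + 2)) (x : Node (c i)) :
      Node (node k c)

namespace Node

/-- The number of regions carried by a node. -/
def weight : {T : PlaneTree} → Node T → ℕ
  | _, root k _ => k + 1
  | _, child _ x => x.weight

/-- The distance of a node to the root. -/
def depth : {T : PlaneTree} → Node T → ℕ
  | _, root _ _ => 0
  | _, child _ x => x.depth + 1

/-- `Below x y`: the node `x` is a proper descendant of `y`. -/
inductive Below : {T : PlaneTree} → Node T → Node T → Prop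
  | root {k : ℕ} {c : Fin (k + 2) → PlaneTree} (i : Fin (k + 2)) (x : Node (c i)) :
      Below (child i x) (root k c)
  | child {k : ℕ} {c : Fin (k + 2) → PlaneTree} {i : Fin (k + 2)} {x y : Node (c i)} :
      Below x y → Below (child (c := c) i x) (child i y)

theorem Below.depth_lt {T : PlaneTree} {x y : Node T} (h : Below x y) : y.depth < x.depth := by
  induction h with
  | root i x => simp [depth]
  | child _ ih => simpa [depth] using ih

theorem weight_pos {T : PlaneTree} (x : Node T) : 0 < x.weight := by
  induction x with
  | root k c => simp [weight]
  | child i x ih => simpa [weight] using ih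

/-- A node is the root or a node of one of the subtrees of the root. -/
def equivOption (k : ℕ) (c : Fin (k + 2) → PlaneTree) :
    Node (node k c) ≃ Option (Σ i, Node (c i)) where
  toFun
    | root _ _ => none
    | child i x => some ⟨i, x⟩
  invFun
    | none => root k c
    | some p => child p.1 p.2
  left_inv x := by cases x <;> rfl
  right_inv x := by cases x <;> rfl

instance isEmpty_leaf : IsEmpty (Node leaf) := ⟨fun x => nomatch x⟩

instance finite (T : PlaneTree) : Finite (Node T) := by
  induction T with
  | leaf => infer_instance
  | node k c ih => exact Finite.of_equiv _ (equivOption k c).symm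

noncomputable instance fintype (T : PlaneTree) : Fintype (Node T) := Fintype.ofFinite _

noncomputable instance decidableEq (T : PlaneTree) : DecidableEq (Node T) := Classical.decEq _

theorem sum_node {M : Type*} [AddCommMonoid M] {k : ℕ} {c : Fin (k + 2) → PlaneTree}
    (f : Node (node k c) → M) : ∑ x, f x = f (root k c) + ∑ i, ∑ x : Node (c i), f (child i x) := by
  rw [← (equivOption k c).symm.sum_comp, Fintype.sum_option, Fintype.sum_sigma]
  rfl

theorem prod_node {M : Type*} [CommMonoid M] {k : ℕ} {c : Fin (k + 2) → PlaneTree}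
    (f : Node (node k c) → M) : ∏ x, f x = f (root k c) * ∏ i, ∏ x : Node (c i), f (child i x) := by
  rw [← (equivOption k c).symm.prod_comp, Fintype.prod_option, Fintype.prod_sigma]
  rfl

/-- The labeling with given label of the root and given labelings of the subtrees. -/
def label {A : Type*} {k : ℕ} {c : Fin (k + 2) → PlaneTree} (a : A) (f : ∀ i, Node (c i) → A) :
    Node (node k c) → A
  | root _ _ => a
  | child i x => f i x

end Node

/-! ### Reading the regions of a tree from left to right. -/

open Node

/-- The list of the regions of a tree from left to right, each region being represented by the
node which carries it. -/
def regionList : (T : PlaneTree) → List (Node T)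
  | leaf => []
  | node k c => [root k c].intercalate (List.ofFn fun i => (regionList (c i)).map (child i))

theorem map_regionList_node {A : Type*} {k : ℕ} {c : Fin (k + 2) → PlaneTree}
    (ℓ : Node (node k c) → A) :
    (regionList (node k c)).map ℓ = [ℓ (root k c)].intercalate
      (List.ofFn fun i => (regionList (c i)).map fun x => ℓ (child i x)) := by
  rw [regionList, List.map_intercalate_singleton, List.map_ofFn]
  simp [Function.comp_def]

theorem mem_regionList {T : PlaneTree} (x : Node T) : x ∈ regionList T := by
  induction x with
  | root k c => simp [regionList, List.mem_intercalate_singleton]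
  | child i x ih =>
    rw [regionList, List.mem_intercalate_singleton]
    exact Or.inl ⟨_, List.mem_ofFn.2 ⟨i, rfl⟩, List.mem_map_of_mem ih⟩

/-- A node of arity a separates a consecutive subtrees, so it is read a - 1 times, which is its
weight. -/
theorem sum_map_regionList {M : Type*} [AddCommMonoid M] {T : PlaneTree} (f : Node T → M) :
    ((regionList T).map f).sum = ∑ x, x.weight • f x := by
  induction T with
  | leaf => simp [regionList]
  | node k c ih =>
    rw [map_regionList_node, List.sum_intercalate_singleton, List.map_ofFn, List.sum_ofFn, sum_node]
    simp [ih, weight, add_comm]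

theorem length_regionList (T : PlaneTree) : (regionList T).length = T.regions := by
  have h := sum_map_regionList (T := T) fun _ => 1
  simp only [List.map_const', List.sum_replicate, smul_eq_mul, mul_one] at h
  rw [h]
  clear h
  induction T with
  | leaf => simp [regions]
  | node k c ih => rw [sum_node]; simp [regions, weight, ih]

theorem count_map_regionList {A : Type*} [DecidableEq A] {T : PlaneTree} (ℓ : Node T → A) (a : A) :
    ((regionList T).map ℓ).count a = ∑ x with ℓ x = a, x.weight := by
  have h := sum_map_regionList (T := T) fun x => if ℓ x = a then 1 else 0
  simp only [smul_eq_mul, mul_ite, mul_one, mul_zero] at h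
  rw [Finset.sum_filter, ← h, List.count_eq_countP, List.countP_map]
  generalize regionList T = L
  induction L with
  | nil => simp
  | cons x L ih => by_cases hx : ℓ x = a <;> simp [ih, hx, add_comm]

theorem toFinset_map_regionList {A : Type*} [DecidableEq A] {T : PlaneTree} (ℓ : Node T → A) :
    ((regionList T).map ℓ).toFinset = Finset.univ.image ℓ := by
  ext a
  simp [mem_regionList]

theorem map_regionList_injective {A : Type*} (T : PlaneTree) :
    Function.Injective fun ℓ : Node T → A => (regionList T).map ℓ := fun _ _ h =>
  funext fun x => List.map_inj_left.1 h x (mem_regionList x)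

/-! ### Decreasing trees of words and strict labelings. -/

/-- A labeling of the nodes is strict if it increases from each node to its ancestors. -/
def IsStrict {A : Type*} [LT A] {T : PlaneTree} (ℓ : Node T → A) : Prop :=
  ∀ x y, Below x y → ℓ x < ℓ y

theorem decreasing_of_max? {u : List ℕ} {m : ℕ} (h : u.max? = some m) :
    decreasing u = node (u.count m - 1) fun i => decreasing ((u.splitOn m).getD i []) := by
  rw [decreasing]
  split
  · simp_all
  · rename_i m' h'
    obtain rfl : m = m' := by simpa [h] using h'
    rfl

theorem decreasing_nil : decreasing [] = leaf := by
  rw [decreasing]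
  split
  · rfl
  · simp_all

/-- The label of the root exceeds all others, so it is the maximal letter, and its occurrences cut
the word exactly into the readings of the subtrees. -/
theorem decreasing_map_regionList {T : PlaneTree} {ℓ : Node T → ℕ} (hℓ : IsStrict ℓ) :
    decreasing ((regionList T).map ℓ) = T := by
  induction T with
  | leaf => exact decreasing_nil
  | node k c ih =>
    have hnot : ∀ l ∈ List.ofFn (fun i => (regionList (c i)).map fun x => ℓ (child i x)),
        ℓ (root k c) ∉ l := by
      intro l hl
      obtain ⟨i, rfl⟩ := List.mem_ofFn.1 hl
      intro h
      obtain ⟨x, -, hx⟩ := List.mem_map.1 h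
      exact absurd hx (hℓ _ _ (Below.root i x)).ne
    have hmax : ((regionList (node k c)).map ℓ).max? = some (ℓ (root k c)) := by
      rw [List.max?_eq_some_iff]
      refine ⟨List.mem_map_of_mem (mem_regionList _), fun b hb => ?_⟩
      obtain ⟨x, -, rfl⟩ := List.mem_map.1 hb
      cases x with
      | root => exact le_rfl
      | child i x => exact (hℓ _ _ (Below.root i x)).le
    rw [decreasing_of_max? hmax, map_regionList_node,
      List.count_intercalate_singleton _ _ hnot, List.splitOn_intercalate _ hnot (by simp)]
    have key : ∀ i : Fin (k + 2), decreasing ((List.ofFn fun i : Fin (k + 2) =>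
        (regionList (c i)).map fun x => ℓ (child i x)).getD i []) = c i := by
      intro i
      rw [List.getD_eq_getElem _ _ (by rw [List.length_ofFn]; exact i.2), List.getElem_ofFn]
      exact ih i fun x y hxy => hℓ _ _ (Below.child hxy)
    have hk : (List.ofFn fun i : Fin (k + 2) =>
        (regionList (c i)).map fun x => ℓ (child i x)).length - 1 - 1 = k := by simp
    rw [hk]
    exact congrArg (node k) (funext key)

/-- The maximal letter labels the root. The pieces between its occurrences avoid it, so the labels
given to the subtrees by induction are strictly smaller. -/
theorem exists_isStrict_of_decreasing {T : PlaneTree} {u : List ℕ} (h : decreasing u = T) :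
    ∃ ℓ : Node T → ℕ, IsStrict ℓ ∧ u = (regionList T).map ℓ := by
  induction T generalizing u with
  | leaf =>
    refine ⟨isEmptyElim, fun x => isEmptyElim x, ?_⟩
    cases hm : u.max? with
    | none => simpa [regionList] using hm
    | some m => rw [decreasing_of_max? hm] at h; cases h
  | node k c ih =>
    cases hm : u.max? with
    | none =>
      rw [List.max?_eq_none_iff] at hm
      rw [hm, decreasing_nil] at h
      cases h
    | some m =>
      rw [decreasing_of_max? hm] at h
      injection h with hk hc
      subst hk
      have hc := eq_of_heq hc
      subst hc
      choose f hf hfu using fun i => ih i rfl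
      rw [List.max?_eq_some_iff] at hm
      have hlen := List.length_splitOn m u
      -- Since `m` occurs in `u`, the arity `u.count m - 1 + 2` equals the number `u.count m + 1` of
      -- pieces, and the default `[]` is never used.
      have hcount := List.count_pos_iff.2 hm.1
      have hu : u = (regionList _).map (label m f) := by
        rw [map_regionList_node]
        conv_lhs => rw [← List.intercalate_splitOn (xs := u) m]
        change _ = [m].intercalate _
        congr 1
        apply List.ext_getElem
        · rw [List.length_ofFn]; omega
        · intro i h1 h2
          rw [List.getElem_ofFn]
          rw [List.length_ofFn] at h2
          have := hfu ⟨i, h2⟩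
          rw [List.getD_eq_getElem _ _ h1] at this
          exact this
      refine ⟨label m f, ?_, hu⟩
      intro x y hxy
      cases hxy with
      | root i x =>
        change f i x < m
        have hx : f i x ∈ (u.splitOn m).getD i [] := by
          rw [hfu i]
          exact List.mem_map_of_mem (mem_regionList x)
        have hi : (i : ℕ) < (u.splitOn m).length := by omega
        rw [List.getD_eq_getElem _ _ hi] at hx
        refine lt_of_le_of_ne (hm.2 _ ?_) ?_
        · rw [hu]
          exact List.mem_map.2 ⟨child i x, mem_regionList _, rfl⟩
        · intro h
          rw [h] at hx
          exact List.notMem_of_mem_splitOn (List.getElem_mem hi) hx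
      | child h => exact hf _ _ _ h

/-- Strictness compares only letters that occur in the word, so a map strictly monotone on those
letters preserves and reflects it. Packing is such a map. -/
theorem exists_isStrict_map_iff {A B : Type*} [LinearOrder A] [LinearOrder B] {T : PlaneTree}
    {z : List A} {f : A → B} (hf : StrictMonoOn f {a | a ∈ z}) :
    (∃ ℓ : Node T → B, IsStrict ℓ ∧ z.map f = (regionList T).map ℓ) ↔
      ∃ ℓ : Node T → A, IsStrict ℓ ∧ z = (regionList T).map ℓ := by
  constructor
  · rintro ⟨ℓ, hℓ, h⟩
    have hmem : ∀ x, ∃ a ∈ z, f a = ℓ x := fun x => by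
      have : ℓ x ∈ z.map f := by rw [h]; exact List.mem_map_of_mem (mem_regionList x)
      exact List.mem_map.1 this
    choose g hg hfg using hmem
    refine ⟨g, fun x y hxy => ?_, ?_⟩
    · rw [← hf.lt_iff_lt (hg x) (hg y), hfg, hfg]
      exact hℓ x y hxy
    · have h2 : z.map f = ((regionList T).map g).map f := by
        rw [h, List.map_map]
        exact List.map_congr_left fun x _ => (hfg x).symm
      have hlen : z.length = ((regionList T).map g).length := by
        simpa using congrArg List.length h2
      refine List.ext_getElem hlen fun i h1 h2' => hf.injOn (List.getElem_mem h1) ?_ ?_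
      · simp only [List.getElem_map, Set.mem_ofPred_eq]
        exact hg _
      · calc f z[i] = (z.map f)[i]'(by simpa using h1) := (List.getElem_map f).symm
        _ = (((regionList T).map g).map f)[i]'(by simpa using h2') := List.getElem_of_eq h2 _
        _ = _ := List.getElem_map f
  · rintro ⟨ℓ, hℓ, hz⟩
    have hmem : ∀ x, ℓ x ∈ z := fun x => hz ▸ List.mem_map_of_mem (mem_regionList x)
    exact ⟨f ∘ ℓ, fun x y hxy => hf (hmem x) (hmem y) (hℓ x y hxy), by simp [hz]⟩

theorem strictMonoOn_card_filter_le {A : Type*} [LinearOrder A] (z : List A) :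
    StrictMonoOn (fun a => (z.toFinset.filter (· ≤ a)).card) {a | a ∈ z} := by
  intro a _ b hb hab
  refine Finset.card_lt_card ⟨fun x hx => ?_, fun h => ?_⟩
  · have hx' := Finset.mem_filter.1 hx
    exact Finset.mem_filter.2 ⟨hx'.1, hx'.2.trans hab.le⟩
  · have hb' := h (Finset.mem_filter.2 ⟨List.mem_toFinset.2 hb, le_rfl⟩)
    exact absurd (Finset.mem_filter.1 hb').2 (not_le.2 hab)

theorem decreasing_packWord_eq_iff {A : Type*} [LinearOrder A] {T : PlaneTree} {z : List A} :
    decreasing (packWord z) = T ↔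
      ∃ ℓ : Node T → A, IsStrict ℓ ∧ z = (regionList T).map ℓ := by
  rw [← exists_isStrict_map_iff (strictMonoOn_card_filter_le z)]
  constructor
  · exact exists_isStrict_of_decreasing
  · rintro ⟨ℓ, hℓ, h⟩
    rw [packWord, h, decreasing_map_regionList hℓ]

/-- The biwords of which the packing has a given decreasing tree. -/
theorem decreasing_packWord_zipWith_eq_iff {A : Type*} [LinearOrder A] {T : PlaneTree} {x : List A}
    {w : List ℕ} (hx : x.length = T.regions) (hw : w.length = T.regions) :
    decreasing (packWord (List.zipWith (fun a b => toLex (a, b)) (packWord x) w)) = T ↔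
      ∃ (ξ : Node T → A) (ω : Node T → ℕ), x = (regionList T).map ξ ∧ w = (regionList T).map ω ∧
        IsStrict fun i => toLex (ξ i, ω i) := by
  set f : A → ℕ := fun a => (x.toFinset.filter (· ≤ a)).card with hf
  have hz : List.zipWith (fun a b => toLex (a, b)) (packWord x) w =
      (List.zipWith (fun a b => toLex (a, b)) x w).map
        fun p => toLex (f (ofLex p).1, (ofLex p).2) := by
    rw [packWord, List.map_zipWith, List.zipWith_map_left]
    rfl
  rw [decreasing_packWord_eq_iff, hz, exists_isStrict_map_iff]
  · constructor
    · rintro ⟨ℓ, hℓ, h⟩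
      refine ⟨fun i => (ofLex (ℓ i)).1, fun i => (ofLex (ℓ i)).2, ?_, ?_, hℓ⟩
      · have := congrArg (List.map fun p => (ofLex p).1) h
        rw [List.map_zipWith, List.map_map] at this
        rw [Function.comp_def] at this
        rw [← this]
        refine List.ext_getElem (by simp [hx, hw]) fun i h1 h2 => by simp
      · have := congrArg (List.map fun p => (ofLex p).2) h
        rw [List.map_zipWith, List.map_map] at this
        rw [Function.comp_def] at this
        rw [← this]
        refine List.ext_getElem (by simp [hx, hw]) fun i h1 h2 => by simp
    · rintro ⟨ξ, ω, rfl, rfl, hℓ⟩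
      exact ⟨_, hℓ, by rw [List.zipWith_map, List.zipWith_self]⟩
  · have hmem : ∀ p ∈ List.zipWith (fun a b => toLex (a, b)) x w, (ofLex p).1 ∈ x := by
      intro p hp
      obtain ⟨i, hi, rfl⟩ := List.getElem_of_mem hp
      simp
    -- Packing only the first word is strictly monotone on the biletters: it is so on first letters,
    -- and it preserves ties.
    intro p hp p' hp' hlt
    have hmono := strictMonoOn_card_filter_le x
    rw [Prod.Lex.lt_iff] at hlt ⊢
    rcases hlt with h | ⟨h, h'⟩
    · exact Or.inl (hmono (hmem p hp) (hmem p' hp') h)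
    · exact Or.inr ⟨congrArg f h, h'⟩

end PlaneTree

/-! ### Coefficients of σ₁((1-t)A), of the adjoint map and of M_T(𝕏). -/

section OneMinus

variable {F : Type*} [Field F]

theorem mem_packedWords {n : ℕ} {u : PackedWord} : u ∈ packedWords n ↔ u.1.length = n := by
  simp [packedWords]

theorem toFinset_eq_Icc_foldr_max (w : PackedWord) :
    w.1.toFinset = Finset.Icc 1 (w.1.foldr max 0) := by
  obtain ⟨w, k, hk⟩ := w
  have h : w.foldr max 0 = k := by
    have h1 : ∀ l : List ℕ, l.foldr max 0 = l.toFinset.sup id := by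
      intro l
      induction l with
      | nil => simp
      | cons a l ih => simp [ih]
    rw [h1, hk]
    apply le_antisymm
    · exact Finset.sup_le fun a ha => (Finset.mem_Icc.1 ha).2
    · rcases Nat.eq_zero_or_pos k with rfl | hpos
      · exact Nat.zero_le _
      · exact Finset.le_sup (f := id) (Finset.mem_Icc.2 ⟨hpos, le_rfl⟩)
  simp only [h, hk]

theorem PackedWord.sum_ev (w : PackedWord) : w.ev.sum = w.1.length := by
  rw [← List.sum_toFinset_count_eq_length, toFinset_eq_Icc_foldr_max, PackedWord.ev]
  generalize w.1.foldr max 0 = k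
  induction k with
  | zero => simp
  | succ k ih =>
    rw [List.range'_1_concat, Finset.sum_Icc_succ_top (by omega), List.map_append, List.sum_append,
      ih]
    simp [add_comm]

theorem PackedWord.ev_pos (w : PackedWord) {j : ℕ} (hj : j ∈ w.ev) : 0 < j := by
  simp only [PackedWord.ev, List.mem_map, List.mem_range'_1] at hj
  obtain ⟨a, ha, rfl⟩ := hj
  rw [List.count_pos_iff, ← List.mem_toFinset, toFinset_eq_Icc_foldr_max, Finset.mem_Icc]
  omega

theorem exists_freeMonoid_of_pos {L : List ℕ} (hL : ∀ j ∈ L, 0 < j) :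
    ∃ I : FreeMonoid ℕ+, I.toList.map (fun i : ℕ+ => (i : ℕ)) = L := by
  refine ⟨FreeMonoid.ofList (L.map Nat.toPNat'), ?_⟩
  rw [FreeMonoid.toList_ofList, List.map_map]
  exact (List.map_congr_left fun j hj => PNat.toPNat'_coe (hL j hj)).trans (List.map_id L)

theorem freeMonoid_ext {I J : FreeMonoid ℕ+}
    (h : I.toList.map (fun i : ℕ+ => (i : ℕ)) = J.toList.map (fun i : ℕ+ => (i : ℕ))) : I = J :=
  FreeMonoid.toList.injective (List.map_injective_iff.2 PNat.coe_injective h)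

/-- A packed word has one evaluation, so `N_w` occurs in a single `S^J`. -/
theorem NCSym.toWQSymDual_apply (f : NCSym F) (w : PackedWord) {J : FreeMonoid ℕ+}
    (hJ : J.toList.map (fun i : ℕ+ => (i : ℕ)) = w.ev) :
    NCSym.toWQSymDual F f w = f.coeff J := by
  classical
  have h : ∀ I : FreeMonoid ℕ+, (∑ u ∈ packedWords ((I.toList.map fun i : ℕ+ => (i : ℕ)).sum) with
      u.ev = I.toList.map (fun i : ℕ+ => (i : ℕ)), WQSymDual.N F u) w = if I = J then 1 else 0 := by
    intro I
    rw [Finsupp.finsetSum_apply]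
    simp only [WQSymDual.N, Finsupp.single_apply]
    rw [Finset.sum_ite_eq']
    refine if_congr ?_ rfl rfl
    rw [Finset.mem_filter, mem_packedWords]
    constructor
    · rintro ⟨-, h⟩
      exact freeMonoid_ext (h.symm.trans hJ.symm)
    · rintro rfl
      exact ⟨by rw [hJ, PackedWord.sum_ev], hJ.symm⟩
  rw [NCSym.toWQSymDual, Finsupp.sum_apply, Finsupp.sum]
  simp only [Finsupp.smul_apply, h, smul_eq_mul, mul_ite, mul_one, mul_zero]
  rw [Finset.sum_ite_eq']
  simp only [Finsupp.mem_support_iff]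
  split_ifs with h0
  · rfl
  · exact (not_not.1 h0).symm

theorem NCSym.coeff_prod_S {L : List ℕ} (hL : ∀ j ∈ L, 0 < j) (J : FreeMonoid ℕ+) :
    (L.map (NCSym.S F)).prod.coeff J =
      if L = J.toList.map (fun i : ℕ+ => (i : ℕ)) then 1 else 0 := by
  classical
  have h : ∀ I : FreeMonoid ℕ+, ((I.toList.map (fun i : ℕ+ => (i : ℕ))).map (NCSym.S F)).prod =
      MonoidAlgebra.single I 1 := by
    intro I
    induction I using FreeMonoid.inductionOn' with
    | one => rfl
    | of_mul i I ih =>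
      have hi : NCSym.S F i = MonoidAlgebra.single (FreeMonoid.of i) 1 := dif_pos i.2
      rw [FreeMonoid.toList_of_mul, List.map_cons, List.map_cons, List.prod_cons, ih, hi,
        MonoidAlgebra.single_mul_single, mul_one]
  obtain ⟨I, rfl⟩ := exists_freeMonoid_of_pos hL
  rw [h, MonoidAlgebra.coeff_single, Finsupp.single_apply]
  exact if_congr ⟨fun h => by rw [h], freeMonoid_ext⟩ rfl rfl

theorem sum_composition_blocks_eq {k : ℕ} {L : List ℕ} (hL : ∀ j ∈ L, 0 < j) :
    ∑ I : Composition k, (-1 : F) ^ (k - I.length) * (if I.blocks = L then 1 else 0) =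
      if L.sum = k then (-1 : F) ^ (k - L.length) else 0 := by
  split_ifs with h
  · let I : Composition k := ⟨L, fun {i} hi => hL i hi, h⟩
    rw [Finset.sum_eq_single I]
    · rw [if_pos rfl, mul_one]
    · intro I' _ hne
      rw [if_neg fun h' => hne (Composition.ext h'), mul_zero]
    · exact fun h => absurd (Finset.mem_univ _) h
  · refine Finset.sum_eq_zero fun I _ => ?_
    rw [if_neg, mul_zero]
    rintro rfl
    exact h I.blocks_sum

theorem length_le_sum_of_pos {L : List ℕ} (hL : ∀ j ∈ L, 0 < j) : L.length ≤ L.sum := by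
  simpa using List.card_nsmul_le_sum L 1 hL

theorem neg_pow_mul_neg_one_pow_sub (t : F) {n r : ℕ} (h : r ≤ n) :
    (-t) ^ n * (-1) ^ (n - r) = (-1) ^ r * t ^ n := by
  obtain ⟨d, rfl⟩ := Nat.exists_eq_add_of_le h
  have : ((-1 : F) ^ d) ^ 2 = 1 := by rw [← pow_mul, mul_comm, pow_mul]; simp
  rw [neg_pow, Nat.add_sub_cancel_left, pow_add (-1 : F)]
  linear_combination (-1) ^ r * t ^ (r + d) * this

/-- The coefficient of `S^J` in `σ₁((1-t)A)`, for `J` with last part `j`. -/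
theorem NCSym.coeff_sigmaOneMinus (t : F) {n j : ℕ} {K : List ℕ} {J : FreeMonoid ℕ+}
    (hJ : J.toList.map (fun i : ℕ+ => (i : ℕ)) = K ++ [j]) (hn : K.sum + j = n) :
    (NCSym.sigmaOneMinus t n).coeff J = (-1) ^ (K.length + 1) * (t ^ n - t ^ (n - j)) := by
  have hpos : ∀ i ∈ K ++ [j], 0 < i := by
    intro i hi
    rw [← hJ] at hi
    obtain ⟨a, -, rfl⟩ := List.mem_map.1 hi
    exact a.2
  have hK : ∀ i ∈ K, 0 < i := fun i hi => hpos i (by simp [hi])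
  have hj : 0 < j := hpos j (by simp)
  have hKl := length_le_sum_of_pos hK
  -- The last complete factor is S₀ = 1 here, so all of J comes from Λₙ.
  have htop : (NCSym.Lam F n * NCSym.S F (n - n)).coeff J = (-1) ^ (n - (K.length + 1)) := by
    have hS : NCSym.S F (n - n) = 1 := by simp [NCSym.S]
    rw [hS, mul_one, NCSym.Lam, MonoidAlgebra.coeff_sum, Finsupp.finsetSum_apply]
    simp only [MonoidAlgebra.coeff_smul, Finsupp.smul_apply, smul_eq_mul]
    rw [Finset.sum_congr rfl fun I _ => by
      rw [NCSym.coeff_prod_S (fun _ h => I.blocks_pos h), hJ], sum_composition_blocks_eq hpos,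
      if_pos (by simpa using hn)]
    simp
  -- For k < n the last complete factor must be the last part j of J, which forces k = n - j and
  -- leaves K to Λₖ.
  have hlow : ∀ k < n, (NCSym.Lam F k * NCSym.S F (n - k)).coeff J =
      if k = n - j then (-1) ^ (k - K.length) else 0 := by
    intro k hk
    have hmul : NCSym.Lam F k * NCSym.S F (n - k) = ∑ I : Composition k,
        (-1 : F) ^ (k - I.length) • ((I.blocks ++ [n - k]).map (NCSym.S F)).prod := by
      rw [NCSym.Lam, Finset.sum_mul]
      exact Finset.sum_congr rfl fun I _ => by simp
    rw [hmul, MonoidAlgebra.coeff_sum, Finsupp.finsetSum_apply]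
    simp only [MonoidAlgebra.coeff_smul, Finsupp.smul_apply, smul_eq_mul]
    have hterm : ∀ I : Composition k,
        (-1 : F) ^ (k - I.length) * ((I.blocks ++ [n - k]).map (NCSym.S F)).prod.coeff J =
          (-1) ^ (k - I.length) * (if I.blocks = K then 1 else 0) *
            (if k = n - j then 1 else 0) := by
      intro I
      rw [NCSym.coeff_prod_S, hJ, mul_assoc]
      · congr 1
        have hiff : I.blocks ++ [n - k] = K ++ [j] ↔ I.blocks = K ∧ k = n - j := by
          constructor
          · intro h
            obtain ⟨h1, h2⟩ := List.append_inj' h rfl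
            refine ⟨h1, ?_⟩
            have := List.singleton_inj.1 h2
            omega
          · rintro ⟨h1, h2⟩
            rw [h1, show n - k = j by omega]
        rw [if_congr hiff rfl rfl, ite_and]
        split_ifs <;> simp
      · intro i hi
        rcases List.mem_append.1 hi with hi | hi
        · exact I.blocks_pos hi
        · rw [List.mem_singleton.1 hi]; omega
    rw [Finset.sum_congr rfl fun I _ => hterm I, ← Finset.sum_mul, sum_composition_blocks_eq hK]
    by_cases hkj : k = n - j
    · simp [hkj, show K.sum = n - j by omega]
    · simp [hkj]
  rw [NCSym.sigmaOneMinus, MonoidAlgebra.coeff_sum, Finsupp.finsetSum_apply,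
    Finset.sum_range_succ]
  simp only [MonoidAlgebra.coeff_smul, Finsupp.smul_apply, smul_eq_mul, htop]
  rw [Finset.sum_eq_single (n - j), hlow (n - j) (by omega), if_pos rfl,
    neg_pow_mul_neg_one_pow_sub t (by omega), neg_pow_mul_neg_one_pow_sub t (by omega)]
  · ring
  · intro k hk hne
    rw [hlow k (Finset.mem_range.1 hk), if_neg hne, mul_zero]
  · intro h
    exact absurd (Finset.mem_range.2 (by omega)) h

/-- The coefficient of `N_w` in `σ₁((1-t)A)`. -/
theorem NCSym.toWQSymDual_sigmaOneMinus_apply (t : F) {w : PackedWord} {k : ℕ} (hk : 0 < k)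
    (hw : w.1.toFinset = Finset.Icc 1 k) :
    NCSym.toWQSymDual F (NCSym.sigmaOneMinus t w.1.length) w =
      (-1) ^ k * (t ^ w.1.length - t ^ (w.1.length - w.1.count k)) := by
  obtain ⟨J, hJ⟩ := exists_freeMonoid_of_pos fun j hj => PackedWord.ev_pos w (j := j) hj
  have hmax : w.1.foldr max 0 = k := by
    have h := toFinset_eq_Icc_foldr_max w
    rw [hw] at h
    simpa using congrArg Finset.card h.symm
  obtain ⟨k, rfl⟩ : ∃ k', k = k' + 1 := ⟨k - 1, by omega⟩
  have hev : w.ev = (List.range' 1 k).map (fun j => w.1.count j) ++ [w.1.count (k + 1)] := by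
    rw [PackedWord.ev, hmax, List.range'_1_concat, List.map_append, add_comm 1 k]
    rfl
  have hsum := PackedWord.sum_ev w
  rw [hev, List.sum_append, List.sum_singleton] at hsum
  rw [NCSym.toWQSymDual_apply _ _ hJ, NCSym.coeff_sigmaOneMinus t (hJ.trans hev) hsum]
  simp

theorem WQSymDual.NOneMinus_apply (t : F) (u v : PackedWord) :
    WQSymDual.NOneMinus t v u = ∑ w ∈ packedWords v.1.length,
      if toPacked (List.zipWith (fun x y => toLex (x, y)) v.1 w.1) = u then
        NCSym.toWQSymDual F (NCSym.sigmaOneMinus t v.1.length) w else 0 := by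
  rw [WQSymDual.NOneMinus, WQSymDual.internalMul, WQSymDual.N, Finsupp.sum_single_index (by simp),
    Finsupp.sum_apply, Finsupp.sum]
  -- One sum runs over a support, the other over the words of the right length: the internal product
  -- kills other lengths, and outside the support the coefficient is zero.
  apply Finset.sum_congr_of_eq_on_inter
  · intro w _ hw
    rw [mem_packedWords] at hw
    rw [if_neg fun h => hw h.symm]
    rfl
  · intro w _ hw
    rw [Finsupp.notMem_support_iff.1 hw, ite_self]
  · intro w _ hw
    rw [mem_packedWords] at hw
    rw [if_pos hw.symm, one_mul, Finsupp.smul_apply, WQSymDual.N, Finsupp.single_apply,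
      smul_eq_mul, mul_ite, mul_one, mul_zero]

theorem WQSym.coeff_atGeometric_M {n m : ℕ} {v : PackedWord} (hv : v.1.length = n) :
    PowerSeries.coeff m (WQSym.atGeometric F (WQSym.M F v)) =
      ∑ x ∈ Finset.Nat.antidiagonalTuple n m,
        if toPacked (List.ofFn fun i => OrderDual.toDual (x i)) = v then 1 else 0 := by
  subst hv
  simp [WQSym.atGeometric, WQSym.M, WQSym.realM]

/-- A word has a single packing, and so has a biword. Hence the sum over `v` in the adjoint
collapses, and the sum over the words `u` of tree `T` leaves only the condition on the tree of the
packed biword. -/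
theorem PlaneTree.coeff_atX_MT (t : F) (T : PlaneTree) (m : ℕ) :
    open Classical in
    PowerSeries.coeff m (WQSym.atX t (PlaneTree.MT F T)) =
      ∑ x ∈ Finset.Nat.antidiagonalTuple T.regions m, ∑ w ∈ packedWords T.regions,
        if PlaneTree.decreasing (packWord (List.zipWith (fun a b => toLex (a, b))
          (packWord (List.ofFn fun i => OrderDual.toDual (x i))) w.1)) = T then
          NCSym.toWQSymDual F (NCSym.sigmaOneMinus t T.regions) w else 0 := by
  classical
  set n := T.regions with hn
  set P := (packedWords n).filter fun u => PlaneTree.decreasing u.1 = T with hP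
  set X : (Fin n → ℕ) → PackedWord := fun x =>
    toPacked (List.ofFn fun i => OrderDual.toDual (x i)) with hX
  have hXlen : ∀ x, (X x).1.length = n := fun x => by simp [hX, toPacked, length_packWord]
  have h1 : PowerSeries.coeff m (WQSym.atX t (PlaneTree.MT F T)) =
      ∑ u ∈ P, ∑ v ∈ packedWords n, WQSymDual.NOneMinus t v u *
        ∑ x ∈ Finset.Nat.antidiagonalTuple n m, if X x = v then 1 else 0 := by
    rw [PlaneTree.MT, map_sum, map_sum]
    refine Finset.sum_congr (by rw [hP]) fun u hu => ?_
    have hu' : u.1.length = n := mem_packedWords.1 (Finset.mem_filter.1 hu).1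
    have h2 : WQSym.timesOneMinus t (WQSym.M F u) =
        ∑ v ∈ packedWords n, WQSymDual.NOneMinus t v u • WQSym.M F v := by
      rw [WQSym.timesOneMinus, WQSym.M, Finsupp.linearCombination_single, one_smul, hu']
    rw [WQSym.atX, LinearMap.comp_apply, h2, map_sum, map_sum]
    refine Finset.sum_congr rfl fun v hv => ?_
    rw [map_smul, PowerSeries.coeff_smul, WQSym.coeff_atGeometric_M (mem_packedWords.1 hv),
      smul_eq_mul]
  rw [h1]
  simp only [Finset.mul_sum, mul_ite, mul_one, mul_zero]
  rw [Finset.sum_congr rfl fun u _ => Finset.sum_comm, Finset.sum_comm]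
  refine Finset.sum_congr rfl fun x _ => ?_
  have h2 : ∀ u ∈ P, (∑ v ∈ packedWords n, if X x = v then WQSymDual.NOneMinus t v u else 0) =
      ∑ w ∈ packedWords n, if toPacked (List.zipWith (fun a b => toLex (a, b)) (X x).1 w.1) = u then
        NCSym.toWQSymDual F (NCSym.sigmaOneMinus t n) w else 0 := by
    intro u _
    rw [Finset.sum_ite_eq, if_pos (mem_packedWords.2 (hXlen x)), WQSymDual.NOneMinus_apply,
      hXlen x]
  rw [Finset.sum_congr rfl h2, Finset.sum_comm]
  refine Finset.sum_congr rfl fun w hw => ?_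
  rw [Finset.sum_ite_eq]
  refine if_congr ?_ rfl rfl
  rw [hP, Finset.mem_filter, mem_packedWords, and_iff_right]
  · rfl
  · have := mem_packedWords.1 hw
    have hx := hXlen x
    simp only [toPacked, length_packWord, List.length_zipWith, this, hx, min_self]

end OneMinus

/-! ### The product formula for sums over increasing labelings. -/

namespace PlaneTree

open Node

variable {F : Type*} [Field F]

/-- A labeling of the nodes is increasing if its labels increase weakly from each node to its
descendants. -/
def IsIncreasing {T : PlaneTree} (ξ : Node T → ℕ) : Prop :=
  ∀ x y, Below x y → ξ y ≤ ξ x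

theorem isIncreasing_node_iff {k : ℕ} {c : Fin (k + 2) → PlaneTree} {ξ : Node (node k c) → ℕ} :
    IsIncreasing ξ ↔ (∀ i (x : Node (c i)), ξ (root k c) ≤ ξ (child i x)) ∧
      ∀ i, IsIncreasing fun x => ξ (child i x) := by
  constructor
  · intro h
    exact ⟨fun i x => h _ _ (Below.root i x), fun i x y hxy => h _ _ (Below.child hxy)⟩
  · rintro ⟨h1, h2⟩ x y hxy
    cases hxy with
    | root i x => exact h1 i x
    | child hxy => exact h2 _ _ _ hxy

/-- The node `x` has a proper ancestor with the same label. -/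
def IsTied {T : PlaneTree} (ξ : Node T → ℕ) (x : Node T) : Prop := ∃ y, Below x y ∧ ξ x = ξ y

theorem isTied_child_iff {k : ℕ} {c : Fin (k + 2) → PlaneTree} {ξ : Node (node k c) → ℕ}
    {i : Fin (k + 2)} {x : Node (c i)} :
    IsTied ξ (child i x) ↔
      ξ (child i x) = ξ (root k c) ∨ IsTied (fun x => ξ (child i x)) x := by
  constructor
  · rintro ⟨y, hy, h⟩
    cases hy with
    | root => exact Or.inl h
    | child hy => exact Or.inr ⟨_, hy, h⟩
  · rintro (h | ⟨y, hy, h⟩)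
    · exact ⟨_, Below.root i x, h⟩
    · exact ⟨_, Below.child hy, h⟩

theorem not_isTied_root {k : ℕ} {c : Fin (k + 2) → PlaneTree} {ξ : Node (node k c) → ℕ} :
    ¬ IsTied ξ (root k c) := by
  rintro ⟨y, hy, -⟩
  cases hy

open Classical in
/-- The contribution of an increasing labeling, where the nodes labeled in `D` are
considered as tied. -/
noncomputable def labelingTerm (t : F) (D : ℕ → Prop) {T : PlaneTree} (ξ : Node T → ℕ) :
    PowerSeries F :=
  ∏ x, (PowerSeries.X ^ (x.weight * ξ x) *
    PowerSeries.C (if D (ξ x) ∨ IsTied ξ x then - t ^ x.weight else 1 - t ^ x.weight))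

open Classical in
/-- The sum of the contributions of the increasing labelings with labels in `[l, N)`. -/
noncomputable def labelingSum (t : F) (D : ℕ → Prop) (l N : ℕ) (T : PlaneTree) : PowerSeries F :=
  ∑ ξ ∈ Fintype.piFinset fun _ : Node T => Finset.Ico l N,
    if IsIncreasing ξ then labelingTerm t D ξ else 0

/-- A labeling of the nodes consists of a label of the root and of labelings of the subtrees. -/
def labelEquiv (A : Type*) (k : ℕ) (c : Fin (k + 2) → PlaneTree) :
    A × (∀ i, Node (c i) → A) ≃ (Node (node k c) → A) where
  toFun p := label p.1 p.2
  invFun ξ := (ξ (root k c), fun i x => ξ (child i x))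
  left_inv _ := rfl
  right_inv ξ := funext fun x => by cases x <;> rfl

/-- Once the root has label r, the labels of the subtrees are at least r, and a node is tied to the
root exactly when its label is r. The subtrees thus become independent, with `(· = r)` as the new
tie condition. The bound on `D` makes the old condition redundant: a label that is at least r ≥ l
and satisfies `D` equals r. -/
theorem labelingSum_node (t : F) {D : ℕ → Prop} [DecidablePred D] {l : ℕ} (hD : ∀ v, D v → v ≤ l) (N k : ℕ)
    (c : Fin (k + 2) → PlaneTree) :
    labelingSum t D l N (node k c) = ∑ r ∈ Finset.Ico l N,
      PowerSeries.X ^ ((k + 1) * r) *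
        PowerSeries.C (if D r then - t ^ (k + 1) else 1 - t ^ (k + 1)) *
        ∏ i, labelingSum t (· = r) r N (c i) := by
  classical
  simp only [labelingSum]
  have hsplit : ∑ ξ ∈ Fintype.piFinset fun _ : Node (node k c) => Finset.Ico l N,
      (if IsIncreasing ξ then labelingTerm t D ξ else 0) =
      ∑ r ∈ Finset.Ico l N, ∑ f ∈ Fintype.piFinset fun i : Fin (k + 2) =>
        Fintype.piFinset fun _ : Node (c i) => Finset.Ico l N,
        (if IsIncreasing (label r f) then labelingTerm t D (label r f) else 0) := by
    rw [← Finset.sum_product']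
    refine (Finset.sum_equiv (labelEquiv ℕ k c) ?_ fun _ _ => rfl).symm
    rintro ⟨r, f⟩
    simp only [Finset.mem_product, Fintype.mem_piFinset]
    constructor
    · rintro ⟨hr, hf⟩ x
      cases x with
      | root => exact hr
      | child i x => exact hf i x
    · intro h
      exact ⟨h (root k c), fun i x => h (child i x)⟩
  rw [hsplit]
  refine Finset.sum_congr rfl fun r hr => ?_
  rw [Finset.prod_univ_sum, Finset.mul_sum]
  have hl := (Finset.mem_Ico.1 hr).1
  symm
  -- A labeling with some subtree label below r is not increasing and contributes zero.
  apply Finset.sum_subset_zero_on_sdiff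
  · intro f hf
    simp only [Fintype.mem_piFinset, Finset.mem_Ico] at hf ⊢
    exact fun i x => ⟨hl.trans (hf i x).1, (hf i x).2⟩
  · intro f hf
    rw [if_neg]
    rw [isIncreasing_node_iff]
    rintro ⟨h, -⟩
    simp only [Finset.mem_sdiff, Fintype.mem_piFinset, Finset.mem_Ico] at hf
    exact hf.2 fun i x => ⟨h i x, (hf.1 i x).2⟩
  · intro f hf
    simp only [Fintype.mem_piFinset, Finset.mem_Ico] at hf
    have hinc : IsIncreasing (label r f) ↔ ∀ i, IsIncreasing (f i) := by
      rw [isIncreasing_node_iff]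
      exact and_iff_right fun i x => (hf i x).1
    by_cases h : ∀ i, IsIncreasing (f i)
    · rw [if_pos (hinc.2 h), labelingTerm, prod_node]
      congr 1
      · simp only [not_isTied_root, or_false]
        congr!
      · refine Finset.prod_congr rfl fun i _ => ?_
        rw [if_pos (h i), labelingTerm]
        refine Finset.prod_congr rfl fun x _ => ?_
        have hfx : label r f (child i x) = f i x := rfl
        have hroot : label r f (root k c) = r := rfl
        have htie : (D (f i x) ∨ IsTied (label r f) (child i x)) ↔
            (f i x = r ∨ IsTied (f i) x) := by
          rw [isTied_child_iff, hfx, hroot]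
          refine ⟨?_, Or.inr⟩
          rintro (h | h)
          · exact Or.inl (le_antisymm ((hD _ h).trans hl) (hf i x).1)
          · exact h
        have hw : (child i x : Node (node k c)).weight = x.weight := rfl
        rw [hfx, hw]
        simp only [htie]
        congr!
    · rw [if_neg fun h' => h (hinc.1 h')]
      obtain ⟨i, hi⟩ := not_forall.1 h
      rw [Finset.prod_eq_zero (Finset.mem_univ i) (if_neg hi), mul_zero]

theorem leaves_eq (T : PlaneTree) : T.leaves = T.regions + 1 := by
  induction T with
  | leaf => rfl
  | node k c ih =>
    simp only [leaves, regions, ih, Finset.sum_add_distrib, Finset.sum_const, Finset.card_univ,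
      Fintype.card_fin, smul_eq_mul]
    omega

/-- The factor of an internal node in the product formula. -/
noncomputable def nodeFactor (t : F) (T : PlaneTree) : PowerSeries F :=
  (PowerSeries.X ^ T.regions - PowerSeries.C (t ^ (T.arity - 1))) *
    (1 - PowerSeries.X ^ (T.leaves - 1))⁻¹

theorem one_sub_X_pow_mul_inv {n : ℕ} (hn : 0 < n) :
    (1 - PowerSeries.X ^ n : PowerSeries F) * (1 - PowerSeries.X ^ n)⁻¹ = 1 :=
  PowerSeries.mul_inv_cancel _ (by simp [hn.ne'])

theorem one_sub_X_pow_mul_sum {n p N : ℕ} (hpN : p ≤ N) :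
    (1 - PowerSeries.X ^ n : PowerSeries F) * ∑ r ∈ Finset.Ico p N, PowerSeries.X ^ (n * r) =
      PowerSeries.X ^ (n * p) - PowerSeries.X ^ (n * N) := by
  induction N, hpN using Nat.le_induction with
  | base => simp
  | succ N hN ih =>
    rw [Finset.sum_Ico_succ_top hN, mul_add, ih]
    ring

theorem prod_map_sum_internalNodes {M : Type*} [CommMonoid M] (f : PlaneTree → M) {k : ℕ}
    (c : Fin (k + 2) → PlaneTree) :
    ((∑ i, (c i).internalNodes).map f).prod = ∏ i, ((c i).internalNodes.map f).prod := by
  have h := map_sum (Multiset.mapAddMonoidHom f) (fun i => (c i).internalNodes) Finset.univ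
  simp only [Multiset.coe_mapAddMonoidHom] at h
  rw [h, Multiset.prod_sum]

theorem mk_X_pow_mul_eq_zero {n N : ℕ} (hn : 0 < n) :
    Ideal.Quotient.mk (Ideal.span {(PowerSeries.X : PowerSeries F) ^ N})
      (PowerSeries.X ^ (n * N)) = 0 :=
  Ideal.Quotient.eq_zero_iff_mem.2 <| Ideal.mem_span_singleton.2 <|
    pow_dvd_pow _ (Nat.le_mul_of_pos_left N hn)

/-- The powers of X given by the subtrees combine with that of the root: the exponents add up to r
times the total number of regions, and the other factors do not depend on r. -/
theorem mk_labelingSum_node {t : F} {D : ℕ → Prop} [DecidablePred D] {l N k : ℕ} {c : Fin (k + 2) → PlaneTree}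
    (hD : ∀ v, D v → v ≤ l) (hc : ∀ i, ∀ r ≤ N,
      Ideal.Quotient.mk (Ideal.span {(PowerSeries.X : PowerSeries F) ^ N})
        (labelingSum t (· = r) r N (c i)) =
      Ideal.Quotient.mk (Ideal.span {(PowerSeries.X : PowerSeries F) ^ N})
        (PowerSeries.X ^ ((c i).regions * r) * ((c i).internalNodes.map (nodeFactor t)).prod)) :
    Ideal.Quotient.mk (Ideal.span {(PowerSeries.X : PowerSeries F) ^ N})
        (labelingSum t D l N (node k c)) =
      Ideal.Quotient.mk (Ideal.span {(PowerSeries.X : PowerSeries F) ^ N})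
        ((∑ r ∈ Finset.Ico l N, PowerSeries.X ^ ((node k c).regions * r) *
            PowerSeries.C (if D r then - t ^ (k + 1) else 1 - t ^ (k + 1))) *
          ∏ i, ((c i).internalNodes.map (nodeFactor t)).prod) := by
  rw [labelingSum_node t hD, Finset.sum_mul, map_sum, map_sum]
  refine Finset.sum_congr rfl fun r hr => ?_
  have hpow : (PowerSeries.X : PowerSeries F) ^ ((node k c).regions * r) =
      PowerSeries.X ^ ((k + 1) * r) * ∏ i, PowerSeries.X ^ ((c i).regions * r) := by
    rw [Finset.prod_pow_eq_pow_sum, ← pow_add, ← Finset.sum_mul, ← add_mul, regions]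
  rw [map_mul, map_prod, Finset.prod_congr rfl fun i _ => hc i r (Finset.mem_Ico.1 hr).2.le,
    ← map_prod, ← map_mul, Finset.prod_mul_distrib, hpow]
  congr 1
  ring

/-- The product formula for the nodes of a tree, modulo `X ^ N`. -/
theorem mk_labelingSum_eq (t : F) (N : ℕ) (T : PlaneTree) {p : ℕ} (hp : p ≤ N) :
    Ideal.Quotient.mk (Ideal.span {(PowerSeries.X : PowerSeries F) ^ N})
        (labelingSum t (· = p) p N T) =
      Ideal.Quotient.mk (Ideal.span {(PowerSeries.X : PowerSeries F) ^ N})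
        (PowerSeries.X ^ (T.regions * p) * (T.internalNodes.map (nodeFactor t)).prod) := by
  induction T generalizing p with
  | leaf =>
    have hinc : ∀ ξ : Node leaf → ℕ, IsIncreasing ξ := fun ξ x => isEmptyElim x
    simp [labelingSum, labelingTerm, hinc, internalNodes, regions]
  | node k c ih =>
    have hnpos : 0 < (node k c).regions := by rw [regions]; omega
    rw [mk_labelingSum_node (fun v hv => hv.le) fun i r hr => ih i hr, internalNodes,
      Multiset.map_cons, Multiset.prod_cons, prod_map_sum_internalNodes, nodeFactor, leaves_eq,
      Nat.add_sub_cancel, show (node k c).arity - 1 = k + 1 from rfl]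
    set n := (node k c).regions with hn
    set π := Ideal.Quotient.mk (Ideal.span {(PowerSeries.X : PowerSeries F) ^ N}) with hπ
    have hXnN : π (PowerSeries.X ^ (n * N)) = 0 := mk_X_pow_mul_eq_zero hnpos
    set Q := ∏ i, ((c i).internalNodes.map (nodeFactor t)).prod with hQ
    set G := ∑ r ∈ Finset.Ico p N, PowerSeries.X ^ (n * r) *
      PowerSeries.C (if r = p then - t ^ (k + 1) else 1 - t ^ (k + 1)) with hG
    have hgeom : π ((1 - PowerSeries.X ^ n) * G) = π (PowerSeries.X ^ (n * p) *
        (PowerSeries.X ^ n - PowerSeries.C (t ^ (k + 1)))) := by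
      rcases hp.eq_or_lt with rfl | hlt
      -- In the boundary case p = N the sum is empty, and X^(nN) vanishes in the quotient.
      · rw [hG, Finset.Ico_self, Finset.sum_empty, mul_zero, map_zero, map_mul, hXnN, zero_mul]
      -- Every r has the factor 1 - t^(k+1), except that the tied value r = p loses 1.
      · have hG' : G = (1 - PowerSeries.C (t ^ (k + 1))) *
            ∑ r ∈ Finset.Ico p N, PowerSeries.X ^ (n * r) - PowerSeries.X ^ (n * p) := by
          have hterm : ∀ r, (PowerSeries.X : PowerSeries F) ^ (n * r) *
              PowerSeries.C (if r = p then - t ^ (k + 1) else 1 - t ^ (k + 1)) =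
              (1 - PowerSeries.C (t ^ (k + 1))) * PowerSeries.X ^ (n * r) -
                if r = p then PowerSeries.X ^ (n * r) else 0 := by
            intro r
            split_ifs
            · simp only [map_neg]
              ring
            · simp only [map_sub, map_one]
              ring
          rw [hG, Finset.sum_congr rfl fun r _ => hterm r, Finset.sum_sub_distrib,
            Finset.sum_ite_eq', if_pos (Finset.mem_Ico.2 ⟨le_rfl, hlt⟩), Finset.mul_sum]
        have h2 : (1 - PowerSeries.X ^ n) * G = PowerSeries.X ^ (n * p) *
            (PowerSeries.X ^ n - PowerSeries.C (t ^ (k + 1))) -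
              (1 - PowerSeries.C (t ^ (k + 1))) * PowerSeries.X ^ (n * N) := by
          rw [hG']
          linear_combination (1 - PowerSeries.C (t ^ (k + 1))) *
            one_sub_X_pow_mul_sum (F := F) (n := n) hp
        rw [h2, map_sub, map_mul π (1 - _), hXnN, mul_zero, sub_zero]
    have hinv := one_sub_X_pow_mul_inv (F := F) hnpos
    -- Multiplying and dividing by 1 - X^n turns the truncated geometric sum into `hgeom`.
    calc π (G * Q) = π ((1 - PowerSeries.X ^ n) * G) * π ((1 - PowerSeries.X ^ n)⁻¹ * Q) := by
          rw [← map_mul]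
          congr 1
          linear_combination (- G * Q) * hinv
      _ = _ := by
          rw [hgeom, ← map_mul]
          congr 1
          ring

/-- The product formula for the sum over all increasing labelings, modulo `X ^ N`. -/
theorem X_pow_dvd_labelingSum_sub (t : F) (N k : ℕ) (c : Fin (k + 2) → PlaneTree) :
    PowerSeries.X ^ N ∣ labelingSum t (fun _ => False) 0 N (node k c) -
      PowerSeries.C (1 - t ^ (k + 1)) * (1 - PowerSeries.X ^ (node k c).regions)⁻¹ *
        ((node k c).properInternalNodes.map (nodeFactor t)).prod := by
  have hnpos : 0 < (node k c).regions := by rw [regions]; omega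
  rw [← Ideal.mem_span_singleton, ← Ideal.Quotient.eq,
    mk_labelingSum_node (fun v hv => hv.elim) fun i r hr => mk_labelingSum_eq t N (c i) hr,
    properInternalNodes, prod_map_sum_internalNodes]
  simp only [if_false]
  set n := (node k c).regions with hn
  set π := Ideal.Quotient.mk (Ideal.span {(PowerSeries.X : PowerSeries F) ^ N}) with hπ
  have hXnN : π (PowerSeries.X ^ (n * N)) = 0 := mk_X_pow_mul_eq_zero hnpos
  have hgeom := one_sub_X_pow_mul_sum (F := F) (n := n) (Nat.zero_le N)
  have hinv := one_sub_X_pow_mul_inv (F := F) hnpos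
  rw [← Finset.sum_mul]
  set G := ∑ r ∈ Finset.Ico 0 N, (PowerSeries.X : PowerSeries F) ^ (n * r) with hG
  rw [mul_zero, pow_zero] at hgeom
  have hGπ : π G = π ((1 - PowerSeries.X ^ n)⁻¹) := by
    have : G = (1 - PowerSeries.X ^ n)⁻¹ - PowerSeries.X ^ (n * N) * (1 - PowerSeries.X ^ n)⁻¹ := by
      linear_combination (1 - PowerSeries.X ^ n)⁻¹ * hgeom - G * hinv
    rw [this, map_sub, map_mul, hXnN, zero_mul, sub_zero]
  rw [map_mul, map_mul, hGπ, ← map_mul, ← map_mul, mul_comm (PowerSeries.C _)]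

end PlaneTree

/-! ### From biwords to increasing labelings. -/

namespace PlaneTree

open Node

variable {F : Type*} [Field F]

/-- The relation between a node and its proper ancestors with the same label. -/
def TiedBelow {T : PlaneTree} (ξ : Node T → ℕ) (x y : Node T) : Prop := Below x y ∧ ξ x = ξ y

/-- Since smaller exponents are larger letters, the first coordinate makes ξ weakly increasing away
from the root, and ω has to decide the ties. -/
theorem isStrict_toLex_iff {T : PlaneTree} {ξ ω : Node T → ℕ} :
    (IsStrict fun i => toLex (OrderDual.toDual (ξ i), ω i)) ↔
      IsIncreasing ξ ∧ ∀ x y, TiedBelow ξ x y → ω x < ω y := by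
  simp only [IsStrict, IsIncreasing, TiedBelow, Prod.Lex.toLex_lt_toLex, OrderDual.toDual_lt_toDual,
    EmbeddingLike.apply_eq_iff_eq]
  constructor
  · intro h
    refine ⟨fun x y hxy => ?_, fun x y hxy => ?_⟩
    · rcases h x y hxy with h | h
      · exact h.le
      · exact h.1.ge
    · rcases h x y hxy.1 with h | h
      · exact absurd hxy.2 h.ne'
      · exact h.2
  · rintro ⟨h1, h2⟩ x y hxy
    rcases (h1 x y hxy).lt_or_eq with h | h
    · exact Or.inl h
    · exact Or.inr ⟨h.symm, h2 x y ⟨hxy, h.symm⟩⟩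

theorem mem_strictPackings_tiedBelow_iff {T : PlaneTree} {ξ ω : Node T → ℕ} :
    ω ∈ strictPackings (TiedBelow ξ) Finset.univ ↔
      IsPackedWord ((regionList T).map ω) ∧ ∀ x y, TiedBelow ξ x y → ω x < ω y := by
  simp [mem_strictPackings, IsStrictPacking, IsPackedWord, toFinset_map_regionList]

theorem sum_weight (T : PlaneTree) : ∑ x : Node T, x.weight = T.regions := by
  rw [← length_regionList]
  have h := sum_map_regionList (T := T) fun _ => 1
  simpa using h.symm

/-- Letter counts of the reading are sums of node weights, so the two powers of t become products
over nodes, the form in which the sum over ω factorizes. -/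
theorem toWQSymDual_sigmaOneMinus_regionList (t : F) {T : PlaneTree} [Nonempty (Node T)]
    {ω : Node T → ℕ} (hω : IsPackedWord ((regionList T).map ω)) :
    NCSym.toWQSymDual F (NCSym.sigmaOneMinus t T.regions) ⟨(regionList T).map ω, hω⟩ =
      (-1) ^ Finset.univ.sup ω * (∏ x : Node T, t ^ x.weight -
        ∏ x with ω x ≠ Finset.univ.sup ω, t ^ x.weight) := by
  obtain ⟨k, hk⟩ := id hω
  have hk' := hk
  rw [toFinset_map_regionList] at hk'
  have hsup : Finset.univ.sup ω = k :=
    sup_eq_of_image_eq_Icc (fun x hx => absurd (Finset.mem_univ x) hx) hk'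
  -- A node exists, so there is a top level; the coefficient formula needs a positive maximal
  -- letter.
  have hpos : 0 < k := by
    have hx := Finset.mem_image_of_mem ω (Finset.mem_univ (Classical.arbitrary (Node T)))
    rw [hk', Finset.mem_Icc] at hx
    omega
  have h := NCSym.toWQSymDual_sigmaOneMinus_apply t (w := ⟨(regionList T).map ω, hω⟩) hpos hk
  simp only [List.length_map, length_regionList, count_map_regionList] at h
  rw [h, hsup, Finset.prod_pow_eq_pow_sum, Finset.prod_pow_eq_pow_sum, sum_weight]
  have h2 := Finset.sum_filter_add_sum_filter_not Finset.univ (fun x => ω x = k)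
    (fun x : Node T => x.weight)
  rw [sum_weight] at h2
  rw [← h2, Nat.add_sub_cancel_left]

theorem ofFn_eq_map_regionList_iff {A : Type*} {T : PlaneTree} {x : Fin T.regions → A}
    {ξ : Node T → A} :
    List.ofFn x = (regionList T).map ξ ↔
      x = fun i => ξ ((regionList T).get (Fin.cast (length_regionList T).symm i)) := by
  have h : List.ofFn (fun i => ξ ((regionList T).get (Fin.cast (length_regionList T).symm i))) =
      (regionList T).map ξ :=
    List.ext_getElem (by simp [length_regionList]) fun i h1 h2 => by simp
  rw [← h, List.ofFn_inj]

theorem coeff_atX_MT_eq_sum_labelings (t : F) (T : PlaneTree) [Nonempty (Node T)] (m : ℕ) :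
    open Classical in
    PowerSeries.coeff m (WQSym.atX t (PlaneTree.MT F T)) =
      ∑ ξ ∈ (Fintype.piFinset fun _ : Node T => Finset.Ico 0 (m + 1)) with
          IsIncreasing ξ ∧ ∑ x, x.weight * ξ x = m,
        ∑ ω ∈ strictPackings (TiedBelow ξ) Finset.univ, (-1) ^ Finset.univ.sup ω *
          (∏ x : Node T, t ^ x.weight - ∏ x with ω x ≠ Finset.univ.sup ω, t ^ x.weight) := by
  classical
  rw [coeff_atX_MT, ← Finset.sum_product', ← Finset.sum_filter, Finset.sum_sigma']
  symm
  have hpack : ∀ p : (Σ _ : Node T → ℕ, Node T → ℕ), p ∈ (Finset.sigma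
      ((Fintype.piFinset fun _ : Node T => Finset.Ico 0 (m + 1)).filter fun ξ =>
        IsIncreasing ξ ∧ ∑ x, x.weight * ξ x = m)
      fun ξ => strictPackings (TiedBelow ξ) Finset.univ) → IsPackedWord ((regionList T).map p.2) :=
    fun p hp => (mem_strictPackings_tiedBelow_iff.1 (Finset.mem_sigma.1 hp).2).1
  have hlen : ∀ x : Fin T.regions → ℕ,
      (List.ofFn fun i => OrderDual.toDual (x i)).length = T.regions := fun x => by simp
  refine Finset.sum_bij (fun p hp =>
    ((fun i => p.1 ((regionList T).get (Fin.cast (length_regionList T).symm i))),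
      ⟨(regionList T).map p.2, hpack p hp⟩)) ?_ ?_ ?_ ?_
  · intro p hp
    have hp' := hp
    rw [Finset.mem_sigma, Finset.mem_filter, mem_strictPackings_tiedBelow_iff] at hp'
    have hw : ((regionList T).map p.2).length = T.regions := by simp [length_regionList]
    rw [Finset.mem_filter, Finset.mem_product, Finset.Nat.mem_antidiagonalTuple, mem_packedWords,
      decreasing_packWord_zipWith_eq_iff (hlen _) hw]
    refine ⟨⟨?_, hw⟩, fun x => OrderDual.toDual (p.1 x), p.2,
      ofFn_eq_map_regionList_iff.2 rfl, rfl, isStrict_toLex_iff.2 ⟨hp'.1.2.1, hp'.2.2⟩⟩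
    rw [← List.sum_ofFn, ofFn_eq_map_regionList_iff.2 rfl, sum_map_regionList]
    exact hp'.1.2.2
  · rintro ⟨ξ, ω⟩ hp ⟨ξ', ω'⟩ hp' h
    rw [Prod.mk.injEq, Subtype.mk.injEq] at h
    have h1 : ξ = ξ' := map_regionList_injective T <|
      (ofFn_eq_map_regionList_iff.2 rfl).symm.trans (ofFn_eq_map_regionList_iff.2 h.1)
    have h2 : ω = ω' := map_regionList_injective T h.2
    rw [h1, h2]
  · rintro ⟨x, w⟩ hxw
    rw [Finset.mem_filter, Finset.mem_product, Finset.Nat.mem_antidiagonalTuple,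
      mem_packedWords] at hxw
    obtain ⟨⟨hx, hw⟩, hdec⟩ := hxw
    rw [decreasing_packWord_zipWith_eq_iff (hlen _) hw] at hdec
    obtain ⟨ξ, ω, hξ, hω, hstrict⟩ := hdec
    rw [ofFn_eq_map_regionList_iff] at hξ
    have hxξ : x = fun i => OrderDual.ofDual
        (ξ ((regionList T).get (Fin.cast (length_regionList T).symm i))) := hξ
    have hsum : ∑ i, i.weight * OrderDual.ofDual (ξ i) = m := by
      rw [← hx, ← List.sum_ofFn, (ofFn_eq_map_regionList_iff (ξ := fun i =>
        OrderDual.ofDual (ξ i))).2 hxξ, sum_map_regionList]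
      rfl
    obtain ⟨h1, h2⟩ := isStrict_toLex_iff (ξ := fun i => OrderDual.ofDual (ξ i)).1 hstrict
    refine ⟨⟨fun i => OrderDual.ofDual (ξ i), ω⟩, ?_, ?_⟩
    · rw [Finset.mem_sigma, Finset.mem_filter, mem_strictPackings_tiedBelow_iff,
        Fintype.mem_piFinset]
      refine ⟨⟨fun i => Finset.mem_Ico.2 ⟨Nat.zero_le _, Nat.lt_succ_of_le ?_⟩, h1, hsum⟩,
        hω ▸ w.2, h2⟩
      -- Weights are positive, so no exponent exceeds m and the range below m + 1 misses no
      -- labeling.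
      calc OrderDual.ofDual (ξ i) ≤ i.weight * OrderDual.ofDual (ξ i) :=
            Nat.le_mul_of_pos_left _ (weight_pos i)
        _ ≤ ∑ i, i.weight * OrderDual.ofDual (ξ i) :=
            Finset.single_le_sum (f := fun i => i.weight * OrderDual.ofDual (ξ i))
              (fun _ _ => Nat.zero_le _) (Finset.mem_univ i)
        _ = m := hsum
    · exact Prod.ext hxξ.symm (Subtype.ext hω.symm)
  · intro p hp
    exact (toWQSymDual_sigmaOneMinus_regionList t (hpack p hp)).symm

/-- For fixed ξ the sum over ω factorizes over the nodes, `depth` being the rank that excludes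
cycles; the tied nodes are those with an equally labeled proper ancestor. -/
theorem coeff_atX_MT_eq_coeff_labelingSum (t : F) (T : PlaneTree) [Nonempty (Node T)] (m : ℕ) :
    PowerSeries.coeff m (WQSym.atX t (PlaneTree.MT F T)) =
      PowerSeries.coeff m (labelingSum t (fun _ => False) 0 (m + 1) T) := by
  classical
  rw [coeff_atX_MT_eq_sum_labelings, labelingSum, map_sum, Finset.sum_filter]
  refine Finset.sum_congr rfl fun ξ _ => ?_
  rw [sum_strictPackings_oneMinus (R := TiedBelow ξ) (d := depth) fun x y h => h.1.depth_lt]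
  have hterm : labelingTerm t (fun _ => False) ξ = PowerSeries.X ^ (∑ x, x.weight * ξ x) *
      PowerSeries.C (∏ x : Node T, if ∃ y, TiedBelow ξ x y then - t ^ x.weight
        else 1 - t ^ x.weight) := by
    rw [labelingTerm, Finset.prod_mul_distrib, Finset.prod_pow_eq_pow_sum, map_prod]
    have htie : ∀ x, (∃ y, TiedBelow ξ x y) ↔ IsTied ξ x := fun x => Iff.rfl
    simp only [false_or, htie]
  by_cases h : IsIncreasing ξ
  · rw [if_pos h, hterm, PowerSeries.coeff_mul_C, PowerSeries.coeff_X_pow]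
    by_cases hm : ∑ x, x.weight * ξ x = m
    · rw [if_pos ⟨h, hm⟩, if_pos hm.symm, one_mul]
    · rw [if_neg fun h' => hm h'.2, if_neg fun h' => hm h'.symm, zero_mul]
  · rw [if_neg fun h' => h h'.1, if_neg h, map_zero]

end PlaneTree

theorem mainTheorem12 {F : Type*} [Field F] (t : F) (T : PlaneTree) (n : ℕ)
    (hn : T.regions = n) (hpos : 1 ≤ n) :
    WQSym.atX t (PlaneTree.MT F T) =
      PowerSeries.C (1 - t ^ (T.arity - 1)) * (1 - PowerSeries.X ^ n)⁻¹ *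
        (T.properInternalNodes.map fun i =>
          (PowerSeries.X ^ i.regions - PowerSeries.C (t ^ (i.arity - 1))) *
            (1 - PowerSeries.X ^ (i.leaves - 1))⁻¹).prod := by
  subst hn
  cases T with
  | leaf => exact absurd hpos (by simp [PlaneTree.regions])
  | node k c =>
    have : Nonempty (PlaneTree.Node (PlaneTree.node k c)) := ⟨PlaneTree.Node.root k c⟩
    ext m
    rw [PlaneTree.coeff_atX_MT_eq_coeff_labelingSum, ← sub_eq_zero, ← map_sub]
    -- The truncation at m + 1 is exact up to and including the coefficient of X^m.
    exact PowerSeries.X_pow_dvd_iff.1 (PlaneTree.X_pow_dvd_labelingSum_sub t (m + 1) k c) m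
      (Nat.lt_succ_self m)
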